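/- Let $\Omega=[a,b]$ with $a<b$, let $k,i\ge 0$ be integers, let $\nu$ be a real number, and let $\theta_1,\dots,\theta_i$ be real numbers with $\theta_j\neq\frac12$ for $1\le j\le i$. For a partition $a=x_{1/2}<x_{3/2}<\dots<x_{N+1/2}=b$ with cells $I_j=[x_{j-1/2},x_{j+1/2}]$ and mesh size $h=\max_j|I_j|$, let $V_h=\{v\in L^2(\Omega): v|_{I_j}\in P^k(I_j)\ \forall j\}$, where $P^k$ denotes the polynomials of degree at most $k$, and let $Z_h=\{v\in V_h:\langle v,1\rangle=0\}$, where $\langle\cdot,\cdot\rangle$ and $\|\cdot\|$ are the inner product and the norm of $L^2(\Omega)$. Let $\Pi_0$ be the $L^2$-orthogonal projection onto $V_h$. For $v\in V_h$, let $v^-_{j+1/2}$ and $v^+_{j+1/2}$ ($1\le j\le N$) be the left and right limits at $x_{j+1/2}$, where the points $a$ and $b$ are identified periodically, and let $[v]=v^+-v^-$. For real $\theta$ the operator $D_{h,\theta}:V_h\to V_h$ is defined by $$\langle D_{h,\theta}w_h,v_h\rangle=-\sum_{j=1}^N\int_{I_j}w_h\,\partial_xv_h\,dx-\sum_{j=1}^N\bigl(\theta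 w_h^-+(1-\theta)w_h^+\bigr)_{j+1/2}[v_h]_{j+1/2}\qquad\forall\, w_h,v_h\in V_h .$$ Then there is a constant $C>0$, depending only on $a,b,k,i,\nu,\theta_1,\dots,\theta_i$, such that for every such partition that is quasi-uniform in the sense that $|I_j|\le\nu|I_l|$ for all $j,l$, the following holds. Each $D_{h,\theta_j}$, $1\le j\le i$, maps $Z_h$ bijectively onto $Z_h$; write $D_{h,\theta_j}^{-1}:Z_h\to Z_h$ for the inverse. For every $(b-a)$-periodic function $w:\mathbb R\to\mathbb R$ of class $C^{k+1+i}$ with $\int_a^bw\,dx=0$ one has $\Pi_0\partial_x^iw\in Z_h$ and $$\bigl\|w-D_{h,\theta_i}^{-1}D_{h,\theta_{i-1}}^{-1}\cdots D_{h,\theta_1}^{-1}\Pi_0\partial_x^iw\bigr\|\le C\,\|w\|_{k+1+i}\,h^{k+1},$$ where $\|w\|_m=\bigl(\sum_{l=0}^m\|\partial_x^lw\|^2\bigr)^{1/2}$ is the Sobolev norm of $H^m(\Omega)$. For $i=0$ the composition of inverses is the identity. -/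

import Mathlib

namespace PeriodicDG

open Polynomial

noncomputable section

/-- A partition `a = x_0 < x_1 < ⋯ < x_N = b` of the interval `[a, b]` into `N` cells. -/
structure Mesh (a b : ℝ) (N : ℕ) where
  node : Fin (N + 1) → ℝ
  node_strictMono : StrictMono node
  node_zero : node 0 = a
  node_last : node (Fin.last N) = b

variable {a b : ℝ} {N : ℕ}

/-- Left endpoint of the cell `I_j`. -/
def Mesh.left (M : Mesh a b N) (j : Fin N) : ℝ := M.node j.castSucc

/-- Right endpoint of the cell `I_j`. -/
def Mesh.right (M : Mesh a b N) (j : Fin N) : ℝ := M.node j.succ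

/-- Length of the cell `I_j`. -/
def Mesh.cellLength (M : Mesh a b N) (j : Fin N) : ℝ := M.right j - M.left j

/-- The mesh size, i.e. the largest cell length. -/
def Mesh.h (M : Mesh a b N) : ℝ := ⨆ j : Fin N, M.cellLength j

/-- Quasi-uniformity with constant `ν`: the ratio of any two cell lengths is at most `ν`. -/
def Mesh.QuasiUniform (M : Mesh a b N) (ν : ℝ) : Prop :=
  ∀ i j : Fin N, M.cellLength i ≤ ν * M.cellLength j

/-- The piecewise polynomial function on `(a, b]` equal to `P j` on the cell `I_j`. -/
def Mesh.pw (M : Mesh a b N) (P : Fin N → ℝ[X]) (x : ℝ) : ℝ :=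
  ∑ j : Fin N, Set.indicator (Set.Ioc (M.left j) (M.right j)) (fun y => (P j).eval y) x

/-- The discontinuous finite element space `V_h`: on each of the `N` cells a polynomial of
degree at most `k`, with no continuity across the interfaces. -/
abbrev DGSpace (N k : ℕ) : Type := Fin N → Polynomial.degreeLT ℝ (k + 1)

variable {k : ℕ}

/-- The element `v` of `V_h` as a real function. -/
def Mesh.toFun (M : Mesh a b N) (v : DGSpace N k) : ℝ → ℝ := M.pw fun j => (v j : ℝ[X])

/-- The cellwise derivative `∂_x v`, as a real function. -/
def Mesh.derivFun (M : Mesh a b N) (v : DGSpace N k) : ℝ → ℝ :=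
  M.pw fun j => derivative (v j : ℝ[X])

/-- The `L²(a, b)` inner product. -/
def ip (a b : ℝ) (f g : ℝ → ℝ) : ℝ := ∫ x in a..b, f x * g x

/-- The `L²(a, b)` norm. -/
def l2norm (a b : ℝ) (f : ℝ → ℝ) : ℝ := √(ip a b f f)

/-- The Sobolev norm of `H^m(a, b)` (for functions of class `C^m`). -/
def sobolevNorm (a b : ℝ) (m : ℕ) (f : ℝ → ℝ) : ℝ :=
  √(∑ l ∈ Finset.range (m + 1), ip a b (iteratedDeriv l f) (iteratedDeriv l f))

/-- The trace `v⁻` at the right end of the cell `I_j` (limit from the left). -/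
def Mesh.traceL (M : Mesh a b N) (v : DGSpace N k) (j : Fin N) : ℝ :=
  (v j : ℝ[X]).eval (M.right j)

/-- The trace `v⁺` at the right end of the cell `I_j` (limit from the right). The cell to the right
is the next one in the cyclic order: the two ends of `[a, b]` form one interface. -/
def Mesh.traceR (M : Mesh a b N) (v : DGSpace N k) (j : Fin N) : ℝ :=
  (v (finRotate N j) : ℝ[X]).eval (M.left (finRotate N j))

/-- The jump `[v] = v⁺ - v⁻` at the right end of the cell `I_j`. -/
def Mesh.jump (M : Mesh a b N) (v : DGSpace N k) (j : Fin N) : ℝ := M.traceR v j - M.traceL v j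

/-- The numerical flux `θ w⁻ + (1 - θ) w⁺` at the right end of the cell `I_j`. -/
def Mesh.flux (M : Mesh a b N) (θ : ℝ) (w : DGSpace N k) (j : Fin N) : ℝ :=
  θ * M.traceL w j + (1 - θ) * M.traceR w j

/-- The form `-⟨w, ∂_x v⟩ - ∑_j ŵ_{j+1/2} [v]_{j+1/2}`. -/
def Mesh.dgForm (M : Mesh a b N) (θ : ℝ) (w v : DGSpace N k) : ℝ :=
  -ip a b (M.toFun w) (M.derivFun v) - ∑ j : Fin N, M.flux θ w j * M.jump v j

open Classical in
/-- The element `z` of `V_h` with `⟨z, v⟩ = F v` for all `v ∈ V_h`. It exists and is unique when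
`F` is linear, see `Mesh.existsUnique_riesz`. -/
def Mesh.riesz (M : Mesh a b N) (F : DGSpace N k → ℝ) : DGSpace N k :=
  if H : ∃ z : DGSpace N k, ∀ v : DGSpace N k, ip a b (M.toFun z) (M.toFun v) = F v
  then H.choose else 0

/-- The operator `D_{h,θ} : V_h → V_h`, see `Mesh.ip_D`. -/
def Mesh.D (M : Mesh a b N) (θ : ℝ) (w : DGSpace N k) : DGSpace N k :=
  M.riesz fun v => M.dgForm θ w v

/-- The `L²` projection `Π₀` onto `V_h`, with polynomial degree `k`, see `Mesh.ip_proj`. -/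
def Mesh.proj (M : Mesh a b N) (k : ℕ) (f : ℝ → ℝ) : DGSpace N k :=
  M.riesz fun v => ip a b f (M.toFun v)

/-- The subspace `Z_h` of the elements of `V_h` that have mean zero. -/
def Mesh.Zh (M : Mesh a b N) (k : ℕ) : Set (DGSpace N k) :=
  {z | ip a b (M.toFun z) (fun _ => 1) = 0}

/-- The inverse of `D_{h,θ}` on `Z_h`. -/
def Mesh.Dinv (M : Mesh a b N) (θ : ℝ) : DGSpace N k → DGSpace N k :=
  Function.invFunOn (M.D θ) (M.Zh k)

/-- The composition `D_{h,θ_i}⁻¹ ⋯ D_{h,θ_1}⁻¹`, the inverse with parameter `θ_1` acting first. -/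
def Mesh.DinvIter (M : Mesh a b N) (θ : ℕ → ℝ) : ℕ → DGSpace N k → DGSpace N k
  | 0, z => z
  | i + 1, z => M.Dinv (θ (i + 1)) (M.DinvIter θ i z)

theorem Mesh.left_lt_right (M : Mesh a b N) (j : Fin N) : M.left j < M.right j :=
  M.node_strictMono Fin.castSucc_lt_succ

theorem Mesh.pw_eq (M : Mesh a b N) (P : Fin N → ℝ[X]) (j : Fin N) {x : ℝ}
    (hx : x ∈ Set.Ioc (M.left j) (M.right j)) : M.pw P x = (P j).eval x := by
  unfold Mesh.pw
  rw [Finset.sum_eq_single j]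
  · rw [Set.indicator_of_mem hx]
  · intro i _ hij
    apply Set.indicator_of_notMem
    intro hi
    rcases lt_or_gt_of_ne hij with h | h
    · have : M.right i ≤ M.left j := M.node_strictMono.monotone (by
        rw [Fin.le_def]; simpa using h)
      exact absurd hx.1 (not_lt.2 (hi.2.trans this))
    · have : M.right j ≤ M.left i := M.node_strictMono.monotone (by
        rw [Fin.le_def]; simpa using h)
      exact absurd hi.1 (not_lt.2 (hx.2.trans this))
  · simp

/-- An integral over `(a, b)` is the sum of the integrals over the cells. -/
theorem Mesh.integral_eq_sum (M : Mesh a b N) (F : ℝ → ℝ)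
    (hF : ∀ j, IntervalIntegrable F MeasureTheory.volume (M.left j) (M.right j)) :
    ∫ x in a..b, F x = ∑ j : Fin N, ∫ x in (M.left j)..(M.right j), F x := by
  let y : ℕ → ℝ := fun n => if h : n < N + 1 then M.node ⟨n, h⟩ else 0
  have hl : ∀ j : Fin N, y j = M.left j := fun j => by
    have : (j : ℕ) < N + 1 := by omega
    simp only [y, this, dif_pos]; rfl
  have hr : ∀ j : Fin N, y (j + 1) = M.right j := fun j => by
    have : (j : ℕ) + 1 < N + 1 := by omega
    simp only [y, this, dif_pos]; rfl
  have h0 : y 0 = a := by rw [← M.node_zero]; simp [y]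
  have hN : y N = b := by rw [← M.node_last]; simp [y, Fin.last]
  have := intervalIntegral.sum_integral_adjacent_intervals (f := F) (a := y) (n := N)
    (μ := MeasureTheory.volume) (fun n hn => by
      have := hF ⟨n, hn⟩
      rwa [← hl ⟨n, hn⟩, ← hr ⟨n, hn⟩] at this)
  rw [h0, hN] at this
  rw [← this, Finset.sum_range]
  exact Finset.sum_congr rfl fun j _ => by rw [hl, hr]

/-- The inner product of a piecewise polynomial with a continuous function, cell by cell. -/
theorem Mesh.ip_cont_pw (M : Mesh a b N) {f : ℝ → ℝ} (hf : Continuous f) (P : Fin N → ℝ[X]) :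
    ip a b f (M.pw P) = ∑ j : Fin N, ∫ x in (M.left j)..(M.right j), f x * (P j).eval x := by
  have key : ∀ j, Set.EqOn (fun x => f x * (P j).eval x) (fun x => f x * M.pw P x)
      (Set.uIoc (M.left j) (M.right j)) := fun j x hx => by
    rw [Set.uIoc_of_le (M.left_lt_right j).le] at hx
    simp only [M.pw_eq P j hx]
  unfold ip
  rw [M.integral_eq_sum]
  · refine Finset.sum_congr rfl fun j _ => ?_
    exact (intervalIntegral.integral_congr_ae (Filter.Eventually.of_forall fun x hx => key j hx)).symm
  · intro j
    exact ((hf.mul (P j).continuous).intervalIntegrable _ _).congr (key j)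

/-- The inner product of two piecewise polynomials, cell by cell. -/
theorem Mesh.ip_pw_pw (M : Mesh a b N) (P Q : Fin N → ℝ[X]) :
    ip a b (M.pw P) (M.pw Q) =
      ∑ j : Fin N, ∫ x in (M.left j)..(M.right j), (P j).eval x * (Q j).eval x := by
  have key : ∀ j, Set.EqOn (fun x => (P j).eval x * (Q j).eval x)
      (fun x => M.pw P x * M.pw Q x) (Set.uIoc (M.left j) (M.right j)) := fun j x hx => by
    rw [Set.uIoc_of_le (M.left_lt_right j).le] at hx
    simp only [M.pw_eq P j hx, M.pw_eq Q j hx]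
  unfold ip
  rw [M.integral_eq_sum]
  · refine Finset.sum_congr rfl fun j _ => ?_
    exact (intervalIntegral.integral_congr_ae (Filter.Eventually.of_forall fun x hx => key j hx)).symm
  · intro j
    exact (((P j).continuous.mul (Q j).continuous).intervalIntegrable _ _).congr (key j)

theorem integral_mul_add {f g g' : ℝ → ℝ} (hf : Continuous f) (hg : Continuous g)
    (hg' : Continuous g') (c d : ℝ) :
    ∫ x in c..d, f x * (g x + g' x) = (∫ x in c..d, f x * g x) + ∫ x in c..d, f x * g' x := by
  simp only [mul_add]
  exact intervalIntegral.integral_add ((hf.mul hg).intervalIntegrable c d)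
    ((hf.mul hg').intervalIntegrable c d)

/-- The `L²` inner product as a bilinear form on `V_h`. -/
def Mesh.ipForm (M : Mesh a b N) (k : ℕ) : DGSpace N k →ₗ[ℝ] DGSpace N k →ₗ[ℝ] ℝ :=
  LinearMap.mk₂ ℝ (fun z v => ip a b (M.toFun z) (M.toFun v))
    (fun z z' v => by
      simp only [Mesh.toFun, Mesh.ip_pw_pw, ← Finset.sum_add_distrib]
      refine Finset.sum_congr rfl fun j _ => ?_
      simpa [mul_comm] using integral_mul_add (v j : ℝ[X]).continuous (z j : ℝ[X]).continuous
        (z' j : ℝ[X]).continuous (M.left j) (M.right j))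
    (fun c z v => by
      simp [Mesh.toFun, Mesh.ip_pw_pw, Finset.mul_sum, mul_assoc])
    (fun z v v' => by
      simp only [Mesh.toFun, Mesh.ip_pw_pw, ← Finset.sum_add_distrib]
      refine Finset.sum_congr rfl fun j _ => ?_
      simpa using integral_mul_add (z j : ℝ[X]).continuous (v j : ℝ[X]).continuous
        (v' j : ℝ[X]).continuous (M.left j) (M.right j))
    (fun c z v => by
      simp [Mesh.toFun, Mesh.ip_pw_pw, Finset.mul_sum, mul_left_comm])

theorem Mesh.eq_zero_of_ip_self (M : Mesh a b N) (z : DGSpace N k)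
    (hz : ip a b (M.toFun z) (M.toFun z) = 0) : z = 0 := by
  rw [Mesh.toFun, Mesh.ip_pw_pw] at hz
  have hnn : ∀ j ∈ Finset.univ, 0 ≤ ∫ x in (M.left j)..(M.right j),
      (z j : ℝ[X]).eval x * (z j : ℝ[X]).eval x := fun j _ =>
    intervalIntegral.integral_nonneg (M.left_lt_right j).le fun x _ => mul_self_nonneg _
  rw [Finset.sum_eq_zero_iff_of_nonneg hnn] at hz
  funext j
  have hj := hz j (Finset.mem_univ j)
  have hc : Continuous fun x => (z j : ℝ[X]).eval x * (z j : ℝ[X]).eval x :=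
    (z j : ℝ[X]).continuous.mul (z j : ℝ[X]).continuous
  apply Subtype.ext
  show (z j : ℝ[X]) = 0
  apply Polynomial.eq_zero_of_infinite_isRoot
  refine (Set.Icc_infinite (M.left_lt_right j)).mono fun x hx => ?_
  by_contra hne
  have : 0 < ∫ x in (M.left j)..(M.right j), (z j : ℝ[X]).eval x * (z j : ℝ[X]).eval x :=
    intervalIntegral.integral_pos (M.left_lt_right j) hc.continuousOn
      (fun x _ => mul_self_nonneg _) ⟨x, hx, mul_self_pos.2 hne⟩
  exact this.ne' hj

/-- Every linear functional on `V_h` is represented by a unique element of `V_h`. -/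
theorem Mesh.existsUnique_riesz (M : Mesh a b N) (F : DGSpace N k →ₗ[ℝ] ℝ) :
    ∃! z : DGSpace N k, ∀ v : DGSpace N k, ip a b (M.toFun z) (M.toFun v) = F v := by
  have : Module.Finite ℝ (Polynomial.degreeLT ℝ (k + 1)) :=
    Module.Finite.equiv (Polynomial.degreeLTEquiv ℝ (k + 1)).symm
  have hinj : Function.Injective (M.ipForm k) := by
    rw [injective_iff_map_eq_zero]
    intro z hz
    exact M.eq_zero_of_ip_self z (by simpa [Mesh.ipForm] using LinearMap.congr_fun hz z)
  have hsurj : Function.Surjective (M.ipForm k) :=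
    (LinearMap.injective_iff_surjective_of_finrank_eq_finrank
      (Subspace.dual_finrank_eq (K := ℝ) (V := DGSpace N k)).symm).1 hinj
  obtain ⟨z, hz⟩ := hsurj F
  refine ⟨z, fun v => by rw [← hz]; rfl, fun z' hz' => hinj ?_⟩
  rw [hz]
  exact LinearMap.ext hz'

theorem Mesh.ip_riesz (M : Mesh a b N) (F : DGSpace N k →ₗ[ℝ] ℝ) (v : DGSpace N k) :
    ip a b (M.toFun (M.riesz F)) (M.toFun v) = F v := by
  have H := (M.existsUnique_riesz F).exists
  rw [Mesh.riesz, dif_pos H]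
  exact H.choose_spec v

/-- The variational identity that defines `D_{h,θ}`. -/
theorem Mesh.ip_D (M : Mesh a b N) (θ : ℝ) (w v : DGSpace N k) :
    ip a b (M.toFun (M.D θ w)) (M.toFun v) =
      -ip a b (M.toFun w) (M.derivFun v) - ∑ j : Fin N, M.flux θ w j * M.jump v j := by
  let F : DGSpace N k →ₗ[ℝ] ℝ :=
    { toFun := fun v => M.dgForm θ w v
      map_add' := fun u v => by
        have h1 : ip a b (M.toFun w) (M.derivFun (u + v)) =
            ip a b (M.toFun w) (M.derivFun u) + ip a b (M.toFun w) (M.derivFun v) := by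
          simp only [Mesh.toFun, Mesh.derivFun, Mesh.ip_pw_pw, ← Finset.sum_add_distrib]
          refine Finset.sum_congr rfl fun j _ => ?_
          simpa using integral_mul_add (w j : ℝ[X]).continuous
            (derivative (u j : ℝ[X])).continuous (derivative (v j : ℝ[X])).continuous
            (M.left j) (M.right j)
        have h2 : ∀ j, M.jump (u + v) j = M.jump u j + M.jump v j := fun j => by
          simp [Mesh.jump, Mesh.traceL, Mesh.traceR]; ring
        simp only [Mesh.dgForm, h1, h2, mul_add, Finset.sum_add_distrib]
        ring
      map_smul' := fun c v => by
        have h1 : ip a b (M.toFun w) (M.derivFun (c • v)) =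
            c * ip a b (M.toFun w) (M.derivFun v) := by
          simp [Mesh.toFun, Mesh.derivFun, Mesh.ip_pw_pw, Finset.mul_sum, mul_left_comm]
        have h2 : ∀ j, M.jump (c • v) j = c * M.jump v j := fun j => by
          simp [Mesh.jump, Mesh.traceL, Mesh.traceR]; ring
        simp only [Mesh.dgForm, h1, h2, mul_left_comm _ c, ← Finset.mul_sum, RingHom.id_apply,
          smul_eq_mul]
        ring }
  exact M.ip_riesz F v

/-- The orthogonality that defines `Π₀`. -/
theorem Mesh.ip_proj (M : Mesh a b N) {f : ℝ → ℝ} (hf : Continuous f) (v : DGSpace N k) :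
    ip a b (M.toFun (M.proj k f)) (M.toFun v) = ip a b f (M.toFun v) := by
  let F : DGSpace N k →ₗ[ℝ] ℝ :=
    { toFun := fun v => ip a b f (M.toFun v)
      map_add' := fun u v => by
        simp only [Mesh.toFun, M.ip_cont_pw hf, ← Finset.sum_add_distrib]
        refine Finset.sum_congr rfl fun j _ => ?_
        simpa using integral_mul_add hf (u j : ℝ[X]).continuous (v j : ℝ[X]).continuous
          (M.left j) (M.right j)
      map_smul' := fun c v => by
        simp [Mesh.toFun, M.ip_cont_pw hf, Finset.mul_sum, mul_left_comm] }
  exact M.ip_riesz F v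

end

end PeriodicDG

namespace PeriodicDG

open Polynomial MeasureTheory

variable {a b : ℝ} {N k : ℕ}

/-! The core is a maximum-norm stability estimate for one operator, `exists_stability`. Suppose that
`D_{h,θ} z` acts on each cell like the derivative of a continuous function `W` with `W a = W b`.
Testing with 1 on a cell shows that the flux of `z` minus `W` is the same constant `c` at all
interfaces. Let `T` be piecewise polynomial with `|W - T| ≤ G` and put `p = z - c - T`. Then the
integrals of `p` against derivatives of test functions, and the fluxes of `p`, are those of `W - T`,
hence of size `G`.

On a cell, the Legendre polynomial as test function ties the two end values of `p` together: `p(r) =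
σ p(l) + O(G)` with `|σ| = 1`. The fluxes then give a cyclic recurrence `θ t_j + (1 - θ) σ t_{j+1} =
O(G)` for the right end values. Since `|θ| ≠ |1 - θ|` exactly when `θ ≠ 1/2`, looking at the largest
`|t_j|` bounds all of them (`cyclic_bound`). The moments of order below `k` and one end value
determine `p`, so `p = O(G)` throughout, with constants independent of the mesh.

The estimate is used twice; mean zero removes `c` each time. With `W` the primitive of `D_{h,θ} z`
and `T = 0` it gives the discrete Poincaré inequality `exists_poincare`, hence bijectivity on `Z_h`
and a uniform bound for the inverse. With `W = w` and `T` a cellwise Taylor-type approximation it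
gives the error of a single inverse, `exists_error_bound_one`. Induction on `i`
(`exists_error_bound`) combines them: if `y` approximates `w'`, then `w - D⁻¹ y = (w - D⁻¹ Π₀ w') +
D⁻¹ (Π₀ w' - y)`. -/

/-! ### Polynomials on one cell: Legendre test function and norm equivalence -/

theorem integral_poly_mul_derivative (p q : ℝ[X]) (l r : ℝ) :
    ∫ x in l..r, p.eval x * (derivative q).eval x =
      p.eval r * q.eval r - p.eval l * q.eval l -
        ∫ x in l..r, (derivative p).eval x * q.eval x :=
  intervalIntegral.integral_mul_deriv_eq_deriv_mul (fun x _ => p.hasDerivAt x)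
    (fun x _ => q.hasDerivAt x) ((derivative p).continuous.intervalIntegrable _ _)
    ((derivative q).continuous.intervalIntegrable _ _)

/-- The `m`-th derivative of a polynomial that vanishes to order `m` at `0` and `1` is orthogonal to
the polynomials of degree less than `m` on `[0, 1]`. -/
theorem integral_mul_iterate_derivative_eq_zero (m : ℕ) : ∀ p F : ℝ[X], p.degree < m →
    (X * (1 - X)) ^ m ∣ F →
    ∫ x in (0 : ℝ)..1, p.eval x * (derivative^[m] F).eval x = 0 := by
  induction m with
  | zero =>
    intro p F hp _
    have : p = 0 := by simpa [Nat.WithBot.lt_zero_iff] using hp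
    simp [this]
  | succ m ih =>
    intro p F hp hF
    rw [Function.iterate_succ_apply', integral_poly_mul_derivative, ih]
    · have h : X * (1 - X) ∣ derivative^[m] F := by
        simpa using pow_sub_dvd_iterate_derivative_of_pow_dvd (m := m) hF
      obtain ⟨g, hg⟩ := h
      simp [hg]
    · by_cases h0 : p.natDegree = 0
      · rw [derivative_of_natDegree_zero h0]; simp
      · refine (degree_lt_iff_coeff_zero _ _).2 fun n hn => ?_
        rw [coeff_derivative, (degree_lt_iff_coeff_zero _ _).1 hp (n + 1) (by omega), zero_mul]
    · exact (pow_dvd_pow _ (Nat.le_succ m)).trans hF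

/-- The shifted Legendre polynomial. -/
theorem exists_legendre (k : ℕ) : ∃ Q : ℝ[X], ∃ σ : ℝ, Q.degree < (k + 1 : ℕ) ∧ |σ| = 1 ∧
    Q.eval 1 = 1 ∧ Q.eval 0 = σ ∧
    ∀ p : ℝ[X], p.degree < k → ∫ x in (0 : ℝ)..1, p.eval x * Q.eval x = 0 := by
  set Q := (shiftedLegendre k).map (Int.castRingHom ℝ) with hQ
  have hQ0 : Q.eval 0 = 1 := by
    rw [← coeff_zero_eq_eval_zero, hQ, coeff_map, coeff_shiftedLegendre]; simp
  have hQ1 : Q.eval 1 = (-1) ^ k := by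
    have := shiftedLegendre_eval_symm k (1 : ℝ)
    rw [sub_self, aeval_def, aeval_def, ← eval_map, ← eval_map] at this
    change Q.eval 1 = (-1) ^ k * Q.eval 0 at this
    rw [this, hQ0, mul_one]
  have hs : ((-1 : ℝ) ^ k) * (-1) ^ k = 1 := by rw [← mul_pow]; simp
  -- Mathlib's polynomial is 1 at 0 and `(-1)^k` at 1; the sign moves the normalization to the right
  -- endpoint.
  refine ⟨C ((-1) ^ k) * Q, (-1) ^ k, ?_, by simp, by simp [hQ1, hs], by simp [hQ0], ?_⟩
  · rw [← smul_eq_C_mul]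
    refine (degree_smul_le _ _).trans_lt ?_
    refine (degree_map_le).trans_lt ?_
    rw [degree_shiftedLegendre]
    exact_mod_cast Nat.lt_succ_self k
  · intro p hp
    -- Rodrigues' formula: up to `k!`, the polynomial is the `k`-th derivative of `X^k (1 - X)^k`.
    have h := congrArg (Polynomial.map (Int.castRingHom ℝ)) (factorial_mul_shiftedLegendre_eq k)
    rw [Polynomial.map_mul, ← iterate_derivative_map] at h
    have h0 := integral_mul_iterate_derivative_eq_zero k p
      ((X ^ k * (1 - (X : ℤ[X])) ^ k).map (Int.castRingHom ℝ)) hp (by simp [mul_pow])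
    rw [← h] at h0
    have hf : (k.factorial : ℝ) ≠ 0 := by positivity
    have e : ∀ x : ℝ, p.eval x * (C ((-1) ^ k) * Q).eval x = ((-1) ^ k / k.factorial) *
        (p.eval x * (((k.factorial : ℤ[X]).map (Int.castRingHom ℝ)) * Q).eval x) := fun x => by
      simp; field_simp
    simp_rw [e]
    rw [intervalIntegral.integral_const_mul, h0, mul_zero]

theorem exists_derivative_eq (k : ℕ) (m : ℝ[X]) (hm : m.degree < k) :
    ∃ q : ℝ[X], q.degree < (k + 1 : ℕ) ∧ derivative q = m := by
  by_cases h0 : m = 0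
  · exact ⟨0, by rw [degree_zero]; exact WithBot.bot_lt_coe _, by simp [h0]⟩
  refine ⟨∑ i ∈ Finset.range k, C (m.coeff i / (i + 1)) * X ^ (i + 1), ?_, ?_⟩
  · rw [← mem_degreeLT]
    refine Submodule.sum_mem _ fun i hi => mem_degreeLT.2 ?_
    refine (degree_C_mul_X_pow_le _ _).trans_lt ?_
    have := Finset.mem_range.1 hi
    exact_mod_cast Nat.succ_lt_succ this
  · rw [derivative_sum]
    conv_rhs => rw [as_sum_range' m k ((natDegree_lt_iff_degree_lt h0).2 hm)]
    refine Finset.sum_congr rfl fun i _ => ?_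
    rw [derivative_C_mul_X_pow, ← C_mul_X_pow_eq_monomial]
    congr 2
    push_cast
    field_simp

theorem degree_derivative_lt_of_degree_lt {k : ℕ} {p : ℝ[X]} (hp : p.degree < (k + 1 : ℕ)) :
    (derivative p).degree < k := by
  refine (degree_lt_iff_coeff_zero _ _).2 fun n hn => ?_
  rw [coeff_derivative, (degree_lt_iff_coeff_zero _ _).1 hp (n + 1) (by omega), zero_mul]

/-- A polynomial of degree at most `k` is determined by its moments of order less than `k` and its
value at the right endpoint. -/
theorem eq_zero_of_moments (k : ℕ) (p : ℝ[X]) (hp : p.degree < (k + 1 : ℕ))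
    (hmom : ∀ i < k, ∫ x in (0 : ℝ)..1, p.eval x * x ^ i = 0) (h1 : p.eval 1 = 0) : p = 0 := by
  -- Write `p = (X - 1) m`. The cofactor has degree below `k`, so the moments force `∫ p m = -∫ (1 -
  -- x) m² = 0`, and the weight is positive inside the cell.
  obtain ⟨m, rfl⟩ := dvd_iff_isRoot.2 h1
  by_cases hm0 : m = 0
  · simp [hm0]
  exfalso
  have hm : m.natDegree < k := by
    rw [degree_mul, degree_X_sub_C, degree_eq_natDegree hm0] at hp
    have : 1 + m.natDegree < k + 1 := by exact_mod_cast hp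
    omega
  have h2 : ∫ x in (0 : ℝ)..1, ((X - C 1) * m).eval x * m.eval x = 0 := by
    have e : ∀ x : ℝ, ((X - C 1) * m).eval x * m.eval x =
        ∑ i ∈ Finset.range k, m.coeff i * (((X - C 1) * m).eval x * x ^ i) := fun x => by
      conv_lhs => rw [eval_eq_sum_range' hm x]
      rw [Finset.mul_sum]
      refine Finset.sum_congr rfl fun i _ => by ring
    simp_rw [e]
    rw [intervalIntegral.integral_finsetSum]
    · refine Finset.sum_eq_zero fun i hi => ?_
      rw [intervalIntegral.integral_const_mul, hmom i (Finset.mem_range.1 hi), mul_zero]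
    · intro i _
      apply Continuous.intervalIntegrable
      fun_prop
  have hex : ∃ x ∈ Set.Ioo (0 : ℝ) 1, m.eval x ≠ 0 := by
    by_contra! hne
    exact hm0 (eq_zero_of_infinite_isRoot _ ((Set.Ioo_infinite one_pos).mono fun x hx => hne x hx))
  obtain ⟨c, hc, hmc⟩ := hex
  have h3 : 0 < ∫ x in (0 : ℝ)..1, (1 - x) * (m.eval x * m.eval x) :=
    intervalIntegral.integral_pos one_pos (by fun_prop)
      (fun x hx => mul_nonneg (by linarith [hx.2]) (mul_self_nonneg _))
      ⟨c, ⟨hc.1.le, hc.2.le⟩, mul_pos (by linarith [hc.2]) (mul_self_pos.2 hmc)⟩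
  have h4 : ∫ x in (0 : ℝ)..1, (1 - x) * (m.eval x * m.eval x) =
      - ∫ x in (0 : ℝ)..1, ((X - C 1) * m).eval x * m.eval x := by
    rw [← intervalIntegral.integral_neg]
    congr 1; funext x; simp; ring
  rw [h4, h2] at h3
  simp at h3

theorem abs_eval_le_sum (k : ℕ) (p : ℝ[X]) (hp : p.degree < (k + 1 : ℕ)) (B : ℝ)
    (hB : ∀ i : Fin (k + 1), |p.coeff i| ≤ B) {x : ℝ} (hx : x ∈ Set.Icc (0 : ℝ) 1) :
    |p.eval x| ≤ (k + 1) * B := by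
  have h : p.natDegree < k + 1 := by
    by_cases h : p = 0
    · subst h; simp
    · exact (natDegree_lt_iff_degree_lt h).2 hp
  rw [eval_eq_sum_range' h x]
  refine (Finset.abs_sum_le_sum_abs _ _).trans ?_
  refine (Finset.sum_le_card_nsmul _ _ B fun i hi => ?_).trans (by simp)
  rw [abs_mul, abs_pow, abs_of_nonneg hx.1]
  exact (mul_le_of_le_one_right (abs_nonneg _) (pow_le_one₀ hx.1 hx.2)).trans
    (hB ⟨i, Finset.mem_range.1 hi⟩)

/-- Norm equivalence on the reference cell. -/
theorem exists_sup_bound (k : ℕ) : ∃ K : ℝ, 0 < K ∧ ∀ p : ℝ[X], p.degree < (k + 1 : ℕ) →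
    ∀ B : ℝ, (∀ i < k, |∫ x in (0 : ℝ)..1, p.eval x * x ^ i| ≤ B) → |p.eval 1| ≤ B →
      ∀ x ∈ Set.Icc (0 : ℝ) 1, |p.eval x| ≤ K * B := by
  let mom (i : ℕ) : ℝ[X] →ₗ[ℝ] ℝ :=
    { toFun := fun p => ∫ x in (0 : ℝ)..1, p.eval x * x ^ i
      map_add' := fun p q => by
        simp only [eval_add, add_mul]
        apply intervalIntegral.integral_add <;> apply Continuous.intervalIntegrable <;> fun_prop
      map_smul' := fun c p => by simp [mul_assoc] }
  -- The map from coefficients to moments and end value is injective on a finite-dimensional space,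
  -- hence bounded below.
  let A : ℝ[X] →ₗ[ℝ] (Fin k → ℝ) × ℝ := (LinearMap.pi fun i : Fin k => mom i).prod (leval 1)
  let T := (A ∘ₗ (degreeLT ℝ (k + 1)).subtype) ∘ₗ (degreeLTEquiv ℝ (k + 1)).symm.toLinearMap
  have hT : T.ker = ⊥ := by
    rw [LinearMap.ker_eq_bot']
    intro c hc
    have h := eq_zero_of_moments k ((degreeLTEquiv ℝ (k + 1)).symm c : ℝ[X])
      (mem_degreeLT.1 ((degreeLTEquiv ℝ (k + 1)).symm c).2)
      (fun i hi => congrFun (congrArg Prod.fst hc) ⟨i, hi⟩) (congrArg Prod.snd hc)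
    simpa using h
  obtain ⟨K, hK, hanti⟩ := T.exists_antilipschitzWith hT
  refine ⟨(k + 1) * K, by positivity, fun p hp B hB h1 x hx => ?_⟩
  have hb := hanti.le_mul_dist (degreeLTEquiv ℝ (k + 1) ⟨p, mem_degreeLT.2 hp⟩) 0
  rw [map_zero, dist_zero_right, dist_zero_right] at hb
  have hB0 : 0 ≤ B := (abs_nonneg _).trans h1
  have hTn : ‖T (degreeLTEquiv ℝ (k + 1) ⟨p, mem_degreeLT.2 hp⟩)‖ ≤ B := by
    have e : T (degreeLTEquiv ℝ (k + 1) ⟨p, mem_degreeLT.2 hp⟩) = A p := by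
      simp [T]
    rw [e]
    refine max_le ((pi_norm_le_iff_of_nonneg hB0).2 fun i => ?_) h1
    exact hB i i.2
  rw [mul_assoc]
  refine abs_eval_le_sum k p hp _ (fun i => ?_) hx
  refine ((norm_le_pi_norm (degreeLTEquiv ℝ (k + 1) ⟨p, mem_degreeLT.2 hp⟩) i).trans hb).trans ?_
  gcongr

/-- A polynomial of degree at most `k` on the reference cell with `k` small moments: its end values
agree up to a sign and a small quantity, and it is controlled by one of them. -/
theorem exists_reference_bound (k : ℕ) : ∃ K σ : ℝ, 0 < K ∧ |σ| = 1 ∧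
    ∀ p : ℝ[X], p.degree < (k + 1 : ℕ) → ∀ G : ℝ, 0 ≤ G →
      (∀ q : ℝ[X], q.degree < (k + 1 : ℕ) →
        |∫ x in (0 : ℝ)..1, p.eval x * (derivative q).eval x| ≤
          G * ∫ x in (0 : ℝ)..1, |(derivative q).eval x|) →
      |p.eval 1 - σ * p.eval 0| ≤ K * G ∧
      ∀ x ∈ Set.Icc (0 : ℝ) 1, |p.eval x| ≤ K * (G + |p.eval 1|) := by
  obtain ⟨Q, σ, hQd, hσ, hQ1, hQ0, hQ⟩ := exists_legendre k
  obtain ⟨K, hK, hsup⟩ := exists_sup_bound k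
  have hI : 0 ≤ ∫ x in (0 : ℝ)..1, |(derivative Q).eval x| :=
    intervalIntegral.integral_nonneg zero_le_one fun x _ => abs_nonneg _
  -- The integral serves the first bound, where `Q` is the test function; `K` serves the second.
  refine ⟨K + ∫ x in (0 : ℝ)..1, |(derivative Q).eval x|, σ, by positivity, hσ,
    fun p hp G hG h => ⟨?_, fun x hx => ?_⟩⟩
  · have e := integral_poly_mul_derivative p Q 0 1
    rw [hQ _ (degree_derivative_lt_of_degree_lt hp), hQ1, hQ0] at e
    have := h Q hQd
    rw [e] at this
    calc |p.eval 1 - σ * p.eval 0| = |p.eval 1 * 1 - p.eval 0 * σ - 0| := by ring_nf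
      _ ≤ _ := this
      _ ≤ _ := by nlinarith [mul_nonneg hK.le hG]
  · have hB : 0 ≤ G + |p.eval 1| := by positivity
    refine (hsup p hp (G + |p.eval 1|) (fun i hi => ?_) (by linarith) x hx).trans
      (by nlinarith [mul_nonneg hI hB])
    -- Each monomial of degree below `k` is the derivative of an admissible test function, so the
    -- hypothesis controls all the moments needed.
    obtain ⟨q, hq, hq'⟩ := exists_derivative_eq k (X ^ i) (by
      rw [degree_X_pow]; exact_mod_cast hi)
    have h1 := h q hq
    rw [hq'] at h1
    simp only [eval_pow, eval_X] at h1
    have h2 : ∫ x in (0 : ℝ)..1, |x ^ i| ≤ ∫ x in (0 : ℝ)..1, (1 : ℝ) := by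
      refine intervalIntegral.integral_mono_on zero_le_one
        (by apply Continuous.intervalIntegrable; fun_prop) (by simp) fun x hx => ?_
      rw [abs_pow, abs_of_nonneg hx.1]
      exact pow_le_one₀ hx.1 hx.2
    have h3 : G * ∫ x in (0 : ℝ)..1, |x ^ i| ≤ G := by
      simpa using mul_le_mul_of_nonneg_left h2 hG
    linarith [abs_nonneg (p.eval 1)]

/-- `exists_reference_bound`, scaled to an arbitrary cell. -/
theorem exists_cell_bound (k : ℕ) : ∃ K σ : ℝ, 0 < K ∧ |σ| = 1 ∧
    ∀ l r : ℝ, l < r → ∀ p : ℝ[X], p.degree < (k + 1 : ℕ) → ∀ G : ℝ, 0 ≤ G →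
      (∀ q : ℝ[X], q.degree < (k + 1 : ℕ) →
        |∫ x in l..r, p.eval x * (derivative q).eval x| ≤
          G * ∫ x in l..r, |(derivative q).eval x|) →
      |p.eval r - σ * p.eval l| ≤ K * G ∧
      ∀ x ∈ Set.Icc l r, |p.eval x| ≤ K * (G + |p.eval r|) := by
  obtain ⟨K, σ, hK, hσ, href⟩ := exists_reference_bound k
  refine ⟨K, σ, hK, hσ, fun l r hlr p hp G hG h => ?_⟩
  have hH : 0 < r - l := sub_pos.2 hlr
  have hdeg : ∀ (p : ℝ[X]) (c d : ℝ), p.degree < (k + 1 : ℕ) →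
      (p.comp (C c * X + C d)).degree < (k + 1 : ℕ) := fun p c d hp => by
    by_cases h0 : p.comp (C c * X + C d) = 0
    · rw [h0, degree_zero]; exact WithBot.bot_lt_coe _
    rw [← natDegree_lt_iff_degree_lt h0]
    have hp0 : p ≠ 0 := by rintro rfl; simp at h0
    refine natDegree_comp_le.trans_lt ?_
    have h1 := (natDegree_lt_iff_degree_lt hp0).2 hp
    have h2 : (C c * X + C d).natDegree ≤ 1 := natDegree_linear_le
    nlinarith
  set p' := p.comp (C (r - l) * X + C l) with hp'
  have ev : ∀ t, p'.eval t = p.eval ((r - l) * t + l) := fun t => by simp [hp']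
  have key := href p' (hdeg _ _ _ hp) G hG (fun q hq => ?_)
  · refine ⟨?_, fun x hx => ?_⟩
    · have := key.1
      rw [ev, ev] at this
      convert this using 4 <;> ring_nf
    · have := key.2 ((x - l) / (r - l)) ⟨div_nonneg (sub_nonneg.2 hx.1) hH.le,
        (div_le_one hH).2 (by linarith [hx.2])⟩
      rw [ev, ev, mul_div_cancel₀ _ hH.ne'] at this
      convert this using 3 <;> ring_nf
  -- The hypothesis is scale invariant: in both integrals the chain-rule factor of the derivative
  -- cancels the Jacobian. Hence `K` does not depend on the cell.
  · set q' := q.comp (C (r - l)⁻¹ * X + C (-l / (r - l))) with hq'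
    have hqd : ∀ t, (derivative q).eval t =
        (r - l) * (derivative q').eval ((r - l) * t + l) := fun t => by
      rw [hq', derivative_comp]
      simp
      rw [← mul_assoc, mul_inv_cancel₀ hH.ne', one_mul]
      congr 1
      field_simp
      ring
    have := h q' (hdeg _ _ _ hq)
    simp_rw [ev, hqd, abs_mul, abs_of_pos hH]
    have i1 := intervalIntegral.integral_comp_mul_add
      (fun x => p.eval x * (derivative q').eval x) (a := 0) (b := 1) hH.ne' l
    have i2 := intervalIntegral.integral_comp_mul_add
      (fun x => |(derivative q').eval x|) (a := 0) (b := 1) hH.ne' l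
    simp only [mul_zero, zero_add, mul_one, sub_add_cancel, smul_eq_mul] at i1 i2
    simp_rw [mul_left_comm _ (r - l)]
    rw [intervalIntegral.integral_const_mul, intervalIntegral.integral_const_mul, i1, i2,
      mul_inv_cancel_left₀ hH.ne', mul_inv_cancel_left₀ hH.ne']
    exact this

/-! ### Cyclic structure of the interfaces and stability of one operator -/

/-- Inside the interval the two points coincide; only the wrap from `b` to `a` needs `W a = W b`. -/
theorem Mesh.apply_left_finRotate (M : Mesh a b N) {W : ℝ → ℝ} (hW : W a = W b) (j : Fin N) :
    W (M.left (finRotate N j)) = W (M.right j) := by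
  obtain _ | n := N
  · exact j.elim0
  rw [finRotate_apply]
  induction j using Fin.lastCases with
  | last =>
    rw [Fin.last_add_one]
    have h1 : M.left 0 = a := M.node_zero
    have h2 : M.right (Fin.last n) = b := M.node_last
    rw [h1, h2, hW]
  | cast j =>
    congr 1
    unfold Mesh.left Mesh.right
    congr 1
    rw [Fin.coeSucc_eq_succ]
    rfl

theorem exists_const_of_finRotate {g : Fin N → ℝ} (hg : ∀ j, g (finRotate N j) = g j) :
    ∃ c, ∀ j, g j = c := by
  obtain _ | n := N
  · exact ⟨0, fun j => j.elim0⟩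
  refine ⟨g 0, fun j => ?_⟩
  induction j using Fin.induction with
  | zero => rfl
  | succ i ih =>
    rw [← ih, ← hg i.castSucc, finRotate_apply, Fin.coeSucc_eq_succ]

/-- The variational identity of `D_{h,θ}` on a single cell. -/
theorem Mesh.integral_D_mul (M : Mesh a b N) (θ : ℝ) (w : DGSpace N k) (j : Fin N)
    (q : degreeLT ℝ (k + 1)) :
    ∫ x in (M.left j)..(M.right j), (M.D θ w j : ℝ[X]).eval x * (q : ℝ[X]).eval x =
      -(∫ x in (M.left j)..(M.right j), (w j : ℝ[X]).eval x * (derivative (q : ℝ[X])).eval x) +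
        M.flux θ w j * (q : ℝ[X]).eval (M.right j) -
        M.flux θ w ((finRotate N).symm j) * (q : ℝ[X]).eval (M.left j) := by
  have h := M.ip_D θ w (Pi.single j q)
  simp only [Mesh.toFun, Mesh.derivFun, Mesh.ip_pw_pw] at h
  have hne : ∀ i, i ≠ j → (Pi.single j q : DGSpace N k) i = 0 := fun i hi => by simp [hi]
  have hself : (Pi.single j q : DGSpace N k) j = q := by simp
  rw [Finset.sum_eq_single j (fun i _ hi => by simp [hne i hi]) (by simp),
    Finset.sum_eq_single j (fun i _ hi => by simp [hne i hi]) (by simp), hself] at h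
  have h2 : ∑ i, M.flux θ w i * M.jump (Pi.single j q : DGSpace N k) i =
      M.flux θ w ((finRotate N).symm j) * (q : ℝ[X]).eval (M.left j) -
        M.flux θ w j * (q : ℝ[X]).eval (M.right j) := by
    simp only [Mesh.jump, mul_sub, Finset.sum_sub_distrib]
    congr 1
    -- Interfaces are indexed by the cell on their left, so the left end of cell `j` belongs to the
    -- interface of its cyclic predecessor.
    · rw [← Equiv.sum_comp (finRotate N).symm, Finset.sum_eq_single j]
      · simp only [Mesh.traceR, Equiv.apply_symm_apply, hself]
      · intro i _ hi
        simp only [Mesh.traceR, Equiv.apply_symm_apply, hne i hi]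
        simp
      · simp
    · rw [Finset.sum_eq_single j]
      · simp [Mesh.traceL]
      · intro i _ hi
        simp [Mesh.traceL, hi]
      · simp
  rw [h, h2]
  ring

/-- A cyclic two-term recurrence with coefficients of different modulus is stable. -/
theorem cyclic_bound (θ τ B : ℝ) (t : Fin N → ℝ)
    (h : ∀ j, |θ * t j + τ * t (finRotate N j)| ≤ B) (j : Fin N) :
    |(|θ| - |τ|)| * |t j| ≤ B := by
  have : Nonempty (Fin N) := ⟨j⟩
  obtain ⟨m, hm⟩ := Finite.exists_max fun j => |t j|
  refine (mul_le_mul_of_nonneg_left (hm j) (abs_nonneg _)).trans ?_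
  have key : ∀ x y : ℝ, |x| ≤ |x + y| + |y| := fun x y => by
    simpa using abs_sub (x + y) y
  -- At an index `m` of maximal `|t m|`, use the relation in which `t m` carries the dominant
  -- coefficient: the one at `m` if this is `θ`, the one at the predecessor of `m` if it is `τ`.
  rcases le_total |τ| |θ| with hc | hc
  · rw [abs_of_nonneg (sub_nonneg.2 hc)]
    have h1 := key (θ * t m) (τ * t (finRotate N m))
    rw [abs_mul, abs_mul τ] at h1
    have h2 := mul_le_mul_of_nonneg_left (hm (finRotate N m)) (abs_nonneg τ)
    linarith [h m]
  · rw [abs_of_nonpos (sub_nonpos.2 hc)]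
    have h1 := key (τ * t m) (θ * t ((finRotate N).symm m))
    rw [abs_mul, abs_mul θ] at h1
    have h2 := mul_le_mul_of_nonneg_left (hm ((finRotate N).symm m)) (abs_nonneg θ)
    have h3 := h ((finRotate N).symm m)
    rw [Equiv.apply_symm_apply, add_comm] at h3
    linarith

/-- If the discrete derivative of `z` is the derivative of the continuous periodic function `W`, then
up to a constant `z` is as close to `W` in the maximum norm as any element of `V_h`. -/
theorem exists_stability (k : ℕ) {θ : ℝ} (hθ : θ ≠ 1 / 2) : ∃ K : ℝ, 0 < K ∧
    ∀ (a b : ℝ) (N : ℕ) (M : Mesh a b N) (z T : DGSpace N k) (W : ℝ → ℝ) (G : ℝ),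
      Continuous W → W a = W b → 0 ≤ G →
      (∀ j, ∀ x ∈ Set.Icc (M.left j) (M.right j), |W x - (T j : ℝ[X]).eval x| ≤ G) →
      (∀ j, ∀ q : degreeLT ℝ (k + 1),
        ∫ x in (M.left j)..(M.right j), (M.D θ z j : ℝ[X]).eval x * (q : ℝ[X]).eval x =
          W (M.right j) * (q : ℝ[X]).eval (M.right j) - W (M.left j) * (q : ℝ[X]).eval (M.left j) -
          ∫ x in (M.left j)..(M.right j), W x * (derivative (q : ℝ[X])).eval x) →
      ∃ c : ℝ, ∀ j, ∀ x ∈ Set.Icc (M.left j) (M.right j),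
        |(z j : ℝ[X]).eval x - c - (T j : ℝ[X]).eval x| ≤ K * G := by
  obtain ⟨K, σ, hK, hσ, hcell⟩ := exists_cell_bound k
  have hσσ : σ * σ = 1 := by
    have := abs_mul_abs_self σ
    rw [hσ] at this; linarith
  -- `|θ| = |1 - θ|` happens only at `θ = 1/2`, the one value at which the recurrence may
  -- degenerate.
  have hδ : 0 < |(|θ| - |1 - θ|)| := by
    rw [abs_pos]
    intro h0
    rcases (abs_eq_abs.1 (sub_eq_zero.1 h0)) with h | h
    · exact hθ (by linarith)
    · linarith
  set δ := |(|θ| - |1 - θ|)| with hδd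
  -- The first two terms bound the flux of `W - T`; the last is the cost of replacing a left end
  -- value by `σ` times the right one.
  set A := |θ| + |1 - θ| + |1 - θ| * K with hA
  have hA0 : 0 ≤ A := by positivity
  refine ⟨K * (1 + A / δ), by positivity, fun a b N M z T W G hWc hW hG hT hD => ?_⟩
  have hz : ∀ j, ∀ q : degreeLT ℝ (k + 1), _ := fun j q => (M.integral_D_mul θ z j q).symm.trans (hD j q)
  -- Test function 1: the flux and `W` have equal increments across each cell.
  obtain ⟨c, hc⟩ : ∃ c, ∀ j, M.flux θ z j - W (M.right j) = c := by
    refine exists_const_of_finRotate fun j => ?_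
    have := hz (finRotate N j) ⟨1, mem_degreeLT.2 (by
      rw [degree_one]; exact_mod_cast Nat.succ_pos k)⟩
    simp [-finRotate_apply, -finRotate_symm_apply] at this
    rw [M.apply_left_finRotate hW] at this
    linarith
  have hlr := fun j => (M.left_lt_right j)
  let p : Fin N → ℝ[X] := fun j => (z j : ℝ[X]) - C c - (T j : ℝ[X])
  have hpd : ∀ j, (p j).degree < (k + 1 : ℕ) := fun j => by
    refine mem_degreeLT.1 (Submodule.sub_mem _ (Submodule.sub_mem _ (z j).2 ?_) (T j).2)
    exact mem_degreeLT.2 (degree_C_le.trans_lt (by exact_mod_cast Nat.succ_pos k))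
  -- Since the flux is `W + c` at both ends, the boundary terms cancel and `p` has the same integral
  -- against `q'` as `W - T`.
  have hint : ∀ j, ∀ q : ℝ[X], q.degree < (k + 1 : ℕ) →
      |∫ x in (M.left j)..(M.right j), (p j).eval x * (derivative q).eval x| ≤
        G * ∫ x in (M.left j)..(M.right j), |(derivative q).eval x| := fun j q hq => by
    have h1 := hz j ⟨q, mem_degreeLT.2 hq⟩
    simp only at h1
    have h2 : ∫ x in (M.left j)..(M.right j), c * (derivative q).eval x =
        c * (q.eval (M.right j) - q.eval (M.left j)) := by
      rw [intervalIntegral.integral_const_mul, intervalIntegral.integral_eq_sub_of_hasDerivAt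
        (fun x _ => q.hasDerivAt x) ((derivative q).continuous.intervalIntegrable _ _)]
    have h3 := hc j
    have h4 := hc ((finRotate N).symm j)
    have h5 := M.apply_left_finRotate hW ((finRotate N).symm j)
    rw [Equiv.apply_symm_apply] at h5
    rw [← h5] at h4
    have e : ∫ x in (M.left j)..(M.right j), (p j).eval x * (derivative q).eval x =
        ∫ x in (M.left j)..(M.right j), (W x - (T j : ℝ[X]).eval x) * (derivative q).eval x := by
      have e1 : ∀ x, (p j).eval x * (derivative q).eval x =
        (z j : ℝ[X]).eval x * (derivative q).eval x - c * (derivative q).eval x -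
          (T j : ℝ[X]).eval x * (derivative q).eval x := fun x => by simp [p]; ring
      simp_rw [e1, sub_mul]
      rw [intervalIntegral.integral_sub, intervalIntegral.integral_sub,
        intervalIntegral.integral_sub, h2]
      · have : M.flux θ z j = c + W (M.right j) := by linarith
        rw [this] at h1
        have : M.flux θ z ((finRotate N).symm j) = c + W (M.left j) := by linarith
        rw [this] at h1
        linarith
      all_goals apply Continuous.intervalIntegrable; fun_prop
    rw [e, ← intervalIntegral.integral_const_mul]
    refine (intervalIntegral.abs_integral_le_integral_abs (hlr j).le).trans ?_
    refine intervalIntegral.integral_mono_on (hlr j).le ?_ ?_ fun x hx => ?_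
    · apply Continuous.intervalIntegrable; fun_prop
    · apply Continuous.intervalIntegrable; fun_prop
    · rw [abs_mul]
      exact mul_le_mul_of_nonneg_right (hT j x hx) (abs_nonneg _)
  have hb := fun j => hcell _ _ (hlr j) (p j) (hpd j) G hG (hint j)
  have hflux : ∀ j, |θ * (p j).eval (M.right j) +
      (1 - θ) * (p (finRotate N j)).eval (M.left (finRotate N j))| ≤ (|θ| + |1 - θ|) * G := by
    intro j
    have e : θ * (p j).eval (M.right j) +
        (1 - θ) * (p (finRotate N j)).eval (M.left (finRotate N j)) =
        θ * (W (M.right j) - (T j : ℝ[X]).eval (M.right j)) +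
        (1 - θ) * (W (M.left (finRotate N j)) -
          (T (finRotate N j) : ℝ[X]).eval (M.left (finRotate N j))) := by
      rw [M.apply_left_finRotate hW]
      have := hc j
      simp only [Mesh.flux, Mesh.traceL, Mesh.traceR] at this
      simp only [p, eval_sub, eval_C]
      linarith
    rw [e, add_mul]
    refine (abs_add_le _ _).trans (add_le_add ?_ ?_)
    · rw [abs_mul]
      exact mul_le_mul_of_nonneg_left (hT _ _ ⟨(hlr _).le, le_rfl⟩) (abs_nonneg _)
    · rw [abs_mul]
      exact mul_le_mul_of_nonneg_left (hT _ _ ⟨le_rfl, (hlr _).le⟩) (abs_nonneg _)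
  have ht := cyclic_bound θ ((1 - θ) * σ) (A * G) (fun j => (p j).eval (M.right j)) (fun j => by
    have h1 := (hb (finRotate N j)).1
    set t := (p (finRotate N j)).eval (M.right (finRotate N j))
    set s := (p (finRotate N j)).eval (M.left (finRotate N j))
    have h2 := hflux j
    have e : θ * (p j).eval (M.right j) + (1 - θ) * σ * t =
        (θ * (p j).eval (M.right j) + (1 - θ) * s) + (1 - θ) * σ * (t - σ * s) := by
      -- This uses `σ² = 1`, that is `s = σ t - σ (t - σ s)`.
      linear_combination ((1 - θ) * s) * hσσ
    rw [e]
    refine (abs_add_le _ _).trans ?_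
    rw [abs_mul, abs_mul, hσ, mul_one]
    have := mul_le_mul_of_nonneg_left h1 (abs_nonneg (1 - θ))
    rw [hA]
    linarith)
  rw [abs_mul, hσ, mul_one] at ht
  refine ⟨c, fun j x hx => ?_⟩
  have h1 := (hb j).2 x hx
  have h2 : |(p j).eval (M.right j)| ≤ A / δ * G := by
    rw [div_mul_eq_mul_div, le_div_iff₀ hδ, mul_comm]
    exact ht j
  calc |(z j : ℝ[X]).eval x - c - (T j : ℝ[X]).eval x| = |(p j).eval x| := by simp [p]
    _ ≤ K * (G + |(p j).eval (M.right j)|) := h1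
    _ ≤ K * (G + A / δ * G) := by gcongr
    _ = _ := by ring

/-! ### Bounded measurable functions and `L²` inequalities -/

/-- Measurable functions that are bounded on `[a, b]`. -/
def BddMeas (a b : ℝ) (f : ℝ → ℝ) : Prop :=
  Measurable f ∧ ∃ B, ∀ x ∈ Set.Icc a b, |f x| ≤ B

namespace BddMeas

variable {f g : ℝ → ℝ}

theorem of_continuous (hf : Continuous f) : BddMeas a b f :=
  ⟨hf.measurable, isCompact_Icc.exists_bound_of_continuousOn hf.continuousOn⟩

theorem add (hf : BddMeas a b f) (hg : BddMeas a b g) : BddMeas a b fun x => f x + g x := by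
  obtain ⟨hf, B, hB⟩ := hf
  obtain ⟨hg, B', hB'⟩ := hg
  exact ⟨hf.add hg, B + B', fun x hx => (abs_add_le _ _).trans (add_le_add (hB x hx) (hB' x hx))⟩

theorem sub (hf : BddMeas a b f) (hg : BddMeas a b g) : BddMeas a b fun x => f x - g x := by
  obtain ⟨hf, B, hB⟩ := hf
  obtain ⟨hg, B', hB'⟩ := hg
  exact ⟨hf.sub hg, B + B', fun x hx => (abs_sub _ _).trans (add_le_add (hB x hx) (hB' x hx))⟩

theorem mul (hf : BddMeas a b f) (hg : BddMeas a b g) : BddMeas a b fun x => f x * g x := by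
  obtain ⟨hf, B, hB⟩ := hf
  obtain ⟨hg, B', hB'⟩ := hg
  refine ⟨hf.mul hg, B * B', fun x hx => ?_⟩
  rw [abs_mul]
  exact mul_le_mul (hB x hx) (hB' x hx) (abs_nonneg _) ((abs_nonneg _).trans (hB x hx))

theorem abs (hf : BddMeas a b f) : BddMeas a b fun x => |f x| := by
  obtain ⟨hf, B, hB⟩ := hf
  exact ⟨hf.abs, B, fun x hx => by rw [abs_abs]; exact hB x hx⟩

theorem intervalIntegrable (hab : a ≤ b) (hf : BddMeas a b f) :
    IntervalIntegrable f volume a b := by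
  obtain ⟨hf, B, hB⟩ := hf
  rw [intervalIntegrable_iff_integrableOn_Ioc_of_le hab]
  refine Measure.integrableOn_of_bounded (M := B) (by simp) hf.aestronglyMeasurable ?_
  filter_upwards [ae_restrict_mem measurableSet_Ioc] with x hx
  exact hB x ⟨hx.1.le, hx.2⟩

end BddMeas

theorem Mesh.bddMeas_pw (M : Mesh a b N) (P : Fin N → ℝ[X]) (c d : ℝ) :
    BddMeas c d (M.pw P) := by
  unfold Mesh.pw
  refine ⟨Finset.measurable_sum _ fun j _ =>
    (P j).continuous.measurable.indicator measurableSet_Ioc, ?_⟩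
  have h : ∀ j : Fin N, ∃ B, ∀ x ∈ Set.Icc (M.left j) (M.right j), |(P j).eval x| ≤ B :=
    fun j => isCompact_Icc.exists_bound_of_continuousOn (P j).continuous.continuousOn
  choose B hB using h
  refine ⟨∑ j, B j, fun x _ => (Finset.abs_sum_le_sum_abs _ _).trans
    (Finset.sum_le_sum fun j _ => ?_)⟩
  have hB0 := (abs_nonneg _).trans (hB j (M.left j) ⟨le_rfl, (M.left_lt_right j).le⟩)
  by_cases hx : x ∈ Set.Ioc (M.left j) (M.right j)
  · rw [Set.indicator_of_mem hx]
    exact hB j x ⟨hx.1.le, hx.2⟩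
  · rw [Set.indicator_of_notMem hx, abs_zero]
    exact hB0

theorem Mesh.bddMeas_toFun (M : Mesh a b N) (z : DGSpace N k) (c d : ℝ) :
    BddMeas c d (M.toFun z) := M.bddMeas_pw _ c d

section ip

variable {f g h : ℝ → ℝ}

theorem ip_self_nonneg (hab : a ≤ b) (f : ℝ → ℝ) : 0 ≤ ip a b f f :=
  intervalIntegral.integral_nonneg hab fun _ _ => mul_self_nonneg _

theorem ip_comm (f g : ℝ → ℝ) : ip a b f g = ip a b g f := by
  simp only [ip, mul_comm]

theorem ip_sub_left (hab : a ≤ b) (hf : BddMeas a b f) (hg : BddMeas a b g) (hh : BddMeas a b h) :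
    ip a b (fun x => f x - g x) h = ip a b f h - ip a b g h := by
  simp only [ip, sub_mul]
  exact intervalIntegral.integral_sub ((hf.mul hh).intervalIntegrable hab)
    ((hg.mul hh).intervalIntegrable hab)

theorem ip_add_left (hab : a ≤ b) (hf : BddMeas a b f) (hg : BddMeas a b g) (hh : BddMeas a b h) :
    ip a b (fun x => f x + g x) h = ip a b f h + ip a b g h := by
  simp only [ip, add_mul]
  exact intervalIntegral.integral_add ((hf.mul hh).intervalIntegrable hab)
    ((hg.mul hh).intervalIntegrable hab)

theorem ip_add_self (hab : a ≤ b) (hf : BddMeas a b f) (hg : BddMeas a b g) :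
    ip a b (fun x => f x + g x) (fun x => f x + g x) =
      ip a b f f + 2 * ip a b f g + ip a b g g := by
  rw [ip_add_left hab hf hg (hf.add hg), ip_comm f, ip_comm g,
    ip_add_left hab hf hg hf, ip_add_left hab hf hg hg, ip_comm g f]
  ring

theorem ip_sub_self (hab : a ≤ b) (hf : BddMeas a b f) (hg : BddMeas a b g) :
    ip a b (fun x => f x - g x) (fun x => f x - g x) =
      ip a b f f - 2 * ip a b f g + ip a b g g := by
  rw [ip_sub_left hab hf hg (hf.sub hg), ip_comm f, ip_comm g,
    ip_sub_left hab hf hg hf, ip_sub_left hab hf hg hg, ip_comm g f]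
  ring

/-- Parallelogram identity with the square of `f - g` dropped. -/
theorem ip_add_self_le (hab : a ≤ b) (hf : BddMeas a b f) (hg : BddMeas a b g) :
    ip a b (fun x => f x + g x) (fun x => f x + g x) ≤ 2 * ip a b f f + 2 * ip a b g g := by
  have h1 := ip_add_self hab hf hg
  have h2 := ip_sub_self hab hf hg
  have h3 := ip_self_nonneg hab fun x => f x - g x
  linarith

theorem ip_self_le_of_abs_le (hab : a ≤ b) (hf : BddMeas a b f) {G : ℝ}
    (hG : ∀ x ∈ Set.Ioo a b, |f x| ≤ G) : ip a b f f ≤ (b - a) * G ^ 2 := by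
  have : ip a b f f ≤ ∫ _ in a..b, G ^ 2 :=
    intervalIntegral.integral_mono_on_of_le_Ioo hab ((hf.mul hf).intervalIntegrable hab) (by simp)
      fun x hx => by
        rw [← abs_mul_abs_self, ← sq]
        exact pow_le_pow_left₀ (abs_nonneg _) (hG x hx) 2
  simpa using this

/-- Cauchy–Schwarz against 1, obtained by expanding the nonnegative variance of `|f|`. -/
theorem sq_integral_abs_le (hab : a ≤ b) (hf : BddMeas a b f) :
    (∫ x in a..b, |f x|) ^ 2 ≤ (b - a) * ip a b f f := by
  rcases hab.eq_or_lt with rfl | hlt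
  · simp
  have hc : BddMeas a b fun _ => (∫ x in a..b, |f x|) / (b - a) := .of_continuous continuous_const
  have h1 := ip_self_nonneg hab fun x => |f x| - (∫ x in a..b, |f x|) / (b - a)
  rw [ip_sub_self hab hf.abs hc] at h1
  simp only [ip, abs_mul_abs_self, intervalIntegral.integral_mul_const,
    intervalIntegral.integral_const, smul_eq_mul] at h1
  have hba : 0 < b - a := sub_pos.2 hlt
  set I := ∫ x in a..b, |f x|
  have h2 : I * (I / (b - a)) = I ^ 2 / (b - a) := by ring
  have h3 : (b - a) * (I / (b - a)) * (I / (b - a)) = I ^ 2 / (b - a) := by field_simp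
  rw [h2, h3] at h1
  have h4 : I ^ 2 / (b - a) ≤ ip a b f f := by
    unfold ip; linarith
  rw [div_le_iff₀ hba] at h4
  linarith

theorem abs_integral_le_integral_abs_of_mem (hab : a ≤ b) (hf : IntervalIntegrable f volume a b)
    {x y : ℝ} (hx : x ∈ Set.Icc a b) (hy : y ∈ Set.Icc a b) :
    |∫ t in x..y, f t| ≤ ∫ t in a..b, |f t| := by
  have h0 : 0 ≤ ∫ t in a..b, |f t| :=
    intervalIntegral.integral_nonneg hab fun x _ => abs_nonneg _
  have h1 : |∫ t in x..y, f t| ≤ |(∫ t in x..y, |f t|)| := by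
    simpa only [Real.norm_eq_abs] using
      intervalIntegral.norm_integral_le_abs_integral_norm (f := f) (a := x) (b := y) (μ := volume)
  refine h1.trans ?_
  rw [← abs_of_nonneg h0]
  refine intervalIntegral.abs_integral_mono_interval ?_
    (Filter.Eventually.of_forall fun x => abs_nonneg _) hf.abs
  rw [Set.uIoc_of_le hab]
  exact Set.Ioc_subset_Ioc (le_min hx.1 hy.1) (max_le hx.2 hy.2)

/-- A function of mean zero that is close to a constant is small. -/
theorem abs_le_of_integral_eq_zero (hab : a < b) (hf : BddMeas a b f) (h0 : ∫ x in a..b, f x = 0)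
    {c G : ℝ} (hc : ∀ x ∈ Set.Ioc a b, |f x - c| ≤ G) {x : ℝ} (hx : x ∈ Set.Ioc a b) :
    |f x| ≤ 2 * G := by
  have h1 : |∫ x in a..b, (f x - c)| ≤ G * |b - a| :=
    intervalIntegral.norm_integral_le_of_norm_le_const (f := fun x => f x - c) (C := G) fun x hx => by
      rw [Set.uIoc_of_le hab.le] at hx
      exact hc x hx
  have hba : 0 < b - a := sub_pos.2 hab
  rw [intervalIntegral.integral_sub (hf.intervalIntegrable hab.le) (by simp), h0,
    intervalIntegral.integral_const, smul_eq_mul, zero_sub, abs_neg, abs_mul, mul_comm,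
    abs_of_pos hba] at h1
  have h2 := le_of_mul_le_mul_right h1 hba
  have h3 : |f x| ≤ |f x - c| + |c| := by simpa using abs_add_le (f x - c) c
  linarith [hc x hx]

end ip

/-! ### Taylor approximation and periodic functions -/

/-- Local polynomial approximation. -/
theorem exists_taylor (k : ℕ) : ∀ f : ℝ → ℝ, ContDiff ℝ ((k + 1 : ℕ) : WithTop ℕ∞) f →
    ∀ l r : ℝ, l ≤ r → ∃ T : ℝ[X], T.degree < (k + 1 : ℕ) ∧ ∀ x ∈ Set.Icc l r,
      |f x - T.eval x| ≤ (r - l) ^ k * ∫ t in l..r, |iteratedDeriv (k + 1) f t| := by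
  induction k with
  | zero =>
    intro f hf l r hlr
    refine ⟨C (f l), degree_C_le.trans_lt (by norm_num), fun x hx => ?_⟩
    have hd : Continuous (deriv f) := by
      simpa using hf.continuous_iteratedDeriv 1 (by norm_num)
    have h1 := intervalIntegral.integral_deriv_eq_sub' f (a := l) (b := x) rfl
      (fun x _ => hf.differentiable (by norm_num) x) hd.continuousOn
    rw [eval_C, ← h1, pow_zero, one_mul, zero_add, iteratedDeriv_one]
    exact abs_integral_le_integral_abs_of_mem hlr (hd.intervalIntegrable _ _) ⟨le_rfl, hlr⟩ hx
  | succ k ih =>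
    intro f hf l r hlr
    have hd : ContDiff ℝ ((k + 1 : ℕ) : WithTop ℕ∞) (deriv f) := by
      rw [Nat.cast_succ, contDiff_succ_iff_deriv] at hf
      exact hf.2.2
    obtain ⟨T, hTd, hT⟩ := ih (deriv f) hd l r hlr
    -- A primitive of the approximation of `f'`, shifted to agree with `f` at `l`; integrating the
    -- error gains a factor `r - l`.
    obtain ⟨q, hqd, hq⟩ := exists_derivative_eq (k + 1) T hTd
    refine ⟨q + C (f l - q.eval l), ?_, fun x hx => ?_⟩
    · refine mem_degreeLT.1 (Submodule.add_mem _ (mem_degreeLT.2 hqd) (mem_degreeLT.2 ?_))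
      exact degree_C_le.trans_lt (by exact_mod_cast Nat.succ_pos _)
    have h1 : ∫ t in l..x, (deriv f t - T.eval t) = (f x - q.eval x) - (f l - q.eval l) := by
      refine intervalIntegral.integral_eq_sub_of_hasDerivAt
        (f := fun t => f t - q.eval t) (fun t _ => ?_) ?_
      · rw [← hq]
        exact ((hf.differentiable (by simp)) t).hasDerivAt.sub (q.hasDerivAt t)
      · exact (hd.continuous.sub T.continuous).intervalIntegrable _ _
    set B := (r - l) ^ k * ∫ t in l..r, |iteratedDeriv (k + 1) (deriv f) t| with hB
    have hB0 : 0 ≤ B := (abs_nonneg _).trans (hT l ⟨le_rfl, hlr⟩)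
    have h2 : |∫ t in l..x, (deriv f t - T.eval t)| ≤ B * |x - l| :=
      intervalIntegral.norm_integral_le_of_norm_le_const (f := fun t => deriv f t - T.eval t)
        (C := B) fun t ht => by
        rw [Set.uIoc_of_le hx.1] at ht
        exact hT t ⟨ht.1.le, ht.2.trans hx.2⟩
    rw [h1, abs_of_nonneg (sub_nonneg.2 hx.1)] at h2
    rw [iteratedDeriv_succ']
    calc |f x - (q + C (f l - q.eval l)).eval x| = |f x - q.eval x - (f l - q.eval l)| := by
          simp only [eval_add, eval_C]; ring_nf
      _ ≤ B * (x - l) := h2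
      _ ≤ B * (r - l) := by gcongr; exact hx.2
      _ = _ := by rw [hB]; ring

theorem periodic_deriv {f : ℝ → ℝ} {c : ℝ} (hf : Function.Periodic f c) :
    Function.Periodic (deriv f) c := fun x => by
  rw [← deriv_comp_add_const]
  congr 1
  funext y
  exact hf y

theorem periodic_iteratedDeriv {f : ℝ → ℝ} {c : ℝ} (hf : Function.Periodic f c) (n : ℕ) :
    Function.Periodic (iteratedDeriv n f) c := by
  induction n with
  | zero => simpa using hf
  | succ n ih =>
    rw [iteratedDeriv_succ]
    exact periodic_deriv ih

theorem periodic_endpoints {f : ℝ → ℝ} (hf : Function.Periodic f (b - a)) : f a = f b := by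
  simpa using (hf a).symm

theorem integral_deriv_periodic {f : ℝ → ℝ} (hf : ContDiff ℝ 1 f)
    (hp : Function.Periodic f (b - a)) : ∫ x in a..b, deriv f x = 0 := by
  rw [intervalIntegral.integral_deriv_eq_sub' f rfl
    (fun x _ => hf.differentiable (by norm_num) x)
    (hf.continuous_deriv (by norm_num)).continuousOn, periodic_endpoints hp, sub_self]

/-- The derivative of a periodic function is bounded by the total variation of its derivative. -/
theorem abs_deriv_le_of_periodic (hab : a < b) {f : ℝ → ℝ} (hf : ContDiff ℝ 2 f)
    (hp : Function.Periodic f (b - a)) {x : ℝ} (hx : x ∈ Set.Icc a b) :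
    |deriv f x| ≤ ∫ t in a..b, |deriv (deriv f) t| := by
  -- Rolle: `f'` vanishes somewhere, so it is the integral of `f''` from that point.
  obtain ⟨c, hc, hc0⟩ := exists_deriv_eq_zero hab hf.continuous.continuousOn (periodic_endpoints hp)
  have hd : ContDiff ℝ 1 (deriv f) := by
    have : ContDiff ℝ (1 + 1) f := by norm_num; exact hf
    exact (contDiff_succ_iff_deriv.1 this).2.2
  have hdd := hd.continuous_deriv (le_refl _)
  have h1 := intervalIntegral.integral_deriv_eq_sub' (deriv f) (a := c) (b := x) rfl
    (fun x _ => hd.differentiable (by norm_num) x) hdd.continuousOn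
  rw [hc0, sub_zero] at h1
  rw [← h1]
  exact abs_integral_le_integral_abs_of_mem hab.le (hdd.intervalIntegrable _ _)
    ⟨hc.1.le, hc.2.le⟩ hx

/-! ### Mesh geometry, linearity of the discrete operator, and the space `Z_h` -/

theorem Mesh.exists_mem_cell (M : Mesh a b N) {x : ℝ} (hx : x ∈ Set.Ioc a b) :
    ∃ j, x ∈ Set.Ioc (M.left j) (M.right j) := by
  by_contra! h
  have key : ∀ i, M.node i < x := fun i => by
    induction i using Fin.induction with
    | zero => rw [M.node_zero]; exact hx.1
    | succ j ih => exact not_le.1 fun h' => h j ⟨ih, h'⟩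
  have := key (Fin.last N)
  rw [M.node_last] at this
  exact absurd hx.2 (not_le.2 this)

theorem Mesh.left_mem (M : Mesh a b N) (j : Fin N) : M.left j ∈ Set.Icc a b := by
  constructor
  · conv_lhs => rw [← M.node_zero]
    exact M.node_strictMono.monotone (Fin.zero_le _)
  · conv_rhs => rw [← M.node_last]
    exact M.node_strictMono.monotone (Fin.le_last _)

theorem Mesh.right_mem (M : Mesh a b N) (j : Fin N) : M.right j ∈ Set.Icc a b := by
  constructor
  · conv_lhs => rw [← M.node_zero]
    exact M.node_strictMono.monotone (Fin.zero_le _)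
  · conv_rhs => rw [← M.node_last]
    exact M.node_strictMono.monotone (Fin.le_last _)

theorem Mesh.cell_subset (M : Mesh a b N) (j : Fin N) :
    Set.Icc (M.left j) (M.right j) ⊆ Set.Icc a b :=
  Set.Icc_subset_Icc (M.left_mem j).1 (M.right_mem j).2

theorem Mesh.cellLength_le_h (M : Mesh a b N) (j : Fin N) : M.right j - M.left j ≤ M.h :=
  le_ciSup (f := fun j => M.cellLength j) (Set.finite_range _).bddAbove j

theorem Mesh.h_nonneg (M : Mesh a b N) : 0 ≤ M.h :=
  Real.iSup_nonneg fun j => sub_nonneg.2 (M.left_lt_right j).le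

theorem Mesh.toFun_eq (M : Mesh a b N) (z : DGSpace N k) (j : Fin N) {x : ℝ}
    (hx : x ∈ Set.Ioc (M.left j) (M.right j)) : M.toFun z x = (z j : ℝ[X]).eval x :=
  M.pw_eq _ j hx

theorem Mesh.pw_sub (M : Mesh a b N) (P Q : Fin N → ℝ[X]) :
    M.pw (fun j => P j - Q j) = fun x => M.pw P x - M.pw Q x := by
  funext x
  simp only [Mesh.pw, ← Finset.sum_sub_distrib]
  refine Finset.sum_congr rfl fun j _ => ?_
  by_cases hx : x ∈ Set.Ioc (M.left j) (M.right j)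
  · simp only [Set.indicator_of_mem hx, eval_sub]
  · simp only [Set.indicator_of_notMem hx, sub_zero]

theorem Mesh.toFun_sub (M : Mesh a b N) (z y : DGSpace N k) :
    M.toFun (z - y) = fun x => M.toFun z x - M.toFun y x := by
  unfold Mesh.toFun
  rw [← M.pw_sub]
  rfl

theorem Mesh.ext_of_ip (M : Mesh a b N) {z y : DGSpace N k}
    (h : ∀ v : DGSpace N k, ip a b (M.toFun z) (M.toFun v) = ip a b (M.toFun y) (M.toFun v)) :
    z = y := by
  have hl : M.ipForm k z = M.ipForm k y := LinearMap.ext h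
  refine sub_eq_zero.1 (M.eq_zero_of_ip_self _ ?_)
  change M.ipForm k (z - y) (z - y) = 0
  rw [LinearMap.map_sub₂, hl, sub_self]

/-- `D_{h,θ}` as a linear map. -/
noncomputable def Mesh.linearD (M : Mesh a b N) (k : ℕ) (θ : ℝ) :
    DGSpace N k →ₗ[ℝ] DGSpace N k where
  toFun := M.D θ
  map_add' w y := by
    refine M.ext_of_ip fun v => ?_
    change _ = M.ipForm k (M.D θ w + M.D θ y) v
    rw [map_add, LinearMap.add_apply]
    change _ = ip a b (M.toFun (M.D θ w)) (M.toFun v) + ip a b (M.toFun (M.D θ y)) (M.toFun v)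
    rw [M.ip_D, M.ip_D, M.ip_D]
    simp only [Mesh.toFun, Mesh.derivFun, Mesh.ip_pw_pw]
    have h1 : ∀ j, ∫ x in (M.left j)..(M.right j), ((w + y) j : ℝ[X]).eval x *
        (derivative (v j : ℝ[X])).eval x =
        (∫ x in (M.left j)..(M.right j), (w j : ℝ[X]).eval x * (derivative (v j : ℝ[X])).eval x) +
        ∫ x in (M.left j)..(M.right j), (y j : ℝ[X]).eval x * (derivative (v j : ℝ[X])).eval x :=
      fun j => by
        simpa [mul_comm] using integral_mul_add (derivative (v j : ℝ[X])).continuous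
          (w j : ℝ[X]).continuous (y j : ℝ[X]).continuous (M.left j) (M.right j)
    have h2 : ∀ j, M.flux θ (w + y) j = M.flux θ w j + M.flux θ y j := fun j => by
      simp [Mesh.flux, Mesh.traceL, Mesh.traceR]; ring
    simp only [h1, h2, add_mul, Finset.sum_add_distrib]
    ring
  map_smul' c w := by
    refine M.ext_of_ip fun v => ?_
    change _ = M.ipForm k (c • M.D θ w) v
    rw [map_smul, LinearMap.smul_apply]
    change _ = c • ip a b (M.toFun (M.D θ w)) (M.toFun v)
    rw [M.ip_D, M.ip_D]
    simp only [Mesh.toFun, Mesh.derivFun, Mesh.ip_pw_pw]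
    have h2 : ∀ j, M.flux θ (c • w) j = c * M.flux θ w j := fun j => by
      simp [Mesh.flux, Mesh.traceL, Mesh.traceR]; ring
    simp only [h2, mul_assoc, ← Finset.mul_sum]
    simp [mul_assoc, ← Finset.mul_sum]
    ring

theorem Mesh.D_sub (M : Mesh a b N) (θ : ℝ) (z y : DGSpace N k) :
    M.D θ (z - y) = M.D θ z - M.D θ y := map_sub (M.linearD k θ) z y

/-- The constant function `1` as an element of `V_h`. -/
noncomputable def oneDG (N k : ℕ) : DGSpace N k := fun _ => ⟨1, mem_degreeLT.2 (by
  rw [degree_one]; exact_mod_cast Nat.succ_pos k)⟩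

theorem Mesh.ip_toFun_oneDG (M : Mesh a b N) (hab : a ≤ b) (k : ℕ) (f : ℝ → ℝ) :
    ip a b f (M.toFun (oneDG N k)) = ∫ x in a..b, f x := by
  refine intervalIntegral.integral_congr_ae (Filter.Eventually.of_forall fun x hx => ?_)
  rw [Set.uIoc_of_le hab] at hx
  obtain ⟨j, hj⟩ := M.exists_mem_cell hx
  simp only [M.toFun_eq _ j hj, oneDG, eval_one, mul_one]

theorem Mesh.mem_Zh (M : Mesh a b N) {z : DGSpace N k} :
    z ∈ M.Zh k ↔ ∫ x in a..b, M.toFun z x = 0 := by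
  simp [Mesh.Zh, ip]

theorem Mesh.sub_mem_Zh (M : Mesh a b N) (hab : a ≤ b) {z y : DGSpace N k} (hz : z ∈ M.Zh k)
    (hy : y ∈ M.Zh k) : z - y ∈ M.Zh k := by
  rw [M.mem_Zh] at *
  rw [M.toFun_sub, intervalIntegral.integral_sub ((M.bddMeas_toFun z a b).intervalIntegrable hab)
    ((M.bddMeas_toFun y a b).intervalIntegrable hab), hz, hy, sub_zero]

/-- The subspace `Z_h` as a submodule. -/
noncomputable def Mesh.submoduleZh (M : Mesh a b N) (k : ℕ) : Submodule ℝ (DGSpace N k) :=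
  ((M.ipForm k).flip (oneDG N k)).ker

theorem Mesh.mem_submoduleZh (M : Mesh a b N) (hab : a ≤ b) {z : DGSpace N k} :
    z ∈ M.submoduleZh k ↔ z ∈ M.Zh k := by
  rw [M.mem_Zh, ← M.ip_toFun_oneDG hab k]
  rfl

/-- The constant 1 has zero cellwise derivative and zero jumps, so the defining form vanishes on it.
-/
theorem Mesh.D_mem_Zh (M : Mesh a b N) (hab : a ≤ b) (θ : ℝ) (z : DGSpace N k) :
    M.D θ z ∈ M.Zh k := by
  rw [M.mem_Zh, ← M.ip_toFun_oneDG hab k, M.ip_D]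
  have h1 : M.derivFun (oneDG N k) = fun _ => 0 := by
    funext x; simp [Mesh.derivFun, Mesh.pw, oneDG]
  have h2 : ∀ j, M.jump (oneDG N k) j = 0 := fun j => by
    simp [Mesh.jump, Mesh.traceL, Mesh.traceR, oneDG]
  simp [h1, h2, ip]

theorem Mesh.proj_mem_Zh (M : Mesh a b N) (hab : a ≤ b) {f : ℝ → ℝ} (hf : Continuous f)
    (h0 : ∫ x in a..b, f x = 0) : M.proj k f ∈ M.Zh k := by
  rw [M.mem_Zh, ← M.ip_toFun_oneDG hab k, M.ip_proj hf, M.ip_toFun_oneDG hab, h0]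

theorem Mesh.integral_proj_mul (M : Mesh a b N) {f : ℝ → ℝ} (hf : Continuous f) (j : Fin N)
    (q : degreeLT ℝ (k + 1)) :
    ∫ x in (M.left j)..(M.right j), (M.proj k f j : ℝ[X]).eval x * (q : ℝ[X]).eval x =
      ∫ x in (M.left j)..(M.right j), f x * (q : ℝ[X]).eval x := by
  have h := M.ip_proj hf (Pi.single j q : DGSpace N k)
  simp only [Mesh.toFun, Mesh.ip_pw_pw, M.ip_cont_pw hf] at h
  have hne : ∀ i, i ≠ j → (Pi.single j q : DGSpace N k) i = 0 := fun i hi => by simp [hi]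
  have hself : (Pi.single j q : DGSpace N k) j = q := by simp
  rwa [Finset.sum_eq_single j (fun i _ hi => by simp [hne i hi]) (by simp),
    Finset.sum_eq_single j (fun i _ hi => by simp [hne i hi]) (by simp), hself] at h

/-! ### Discrete Poincaré inequality and bijectivity -/

/-- Differentiability in the open cell, together with continuity of the primitive up to the ends, is
enough to integrate by parts over the cell. -/
theorem Mesh.hasDerivAt_primitive (M : Mesh a b N) (z : DGSpace N k) (j : Fin N)
    {x : ℝ} (hx : x ∈ Set.Ioo (M.left j) (M.right j)) :
    HasDerivAt (fun y => ∫ t in a..y, M.toFun z t) ((z j : ℝ[X]).eval x) x := by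
  rw [← M.toFun_eq z j ⟨hx.1, hx.2.le⟩]
  have hax : a ≤ x := (M.left_mem j).1.trans hx.1.le
  refine intervalIntegral.integral_hasDerivAt_right
    ((M.bddMeas_toFun z a x).intervalIntegrable hax)
    (M.bddMeas_toFun z a b).1.stronglyMeasurable.stronglyMeasurableAtFilter ?_
  refine ((z j : ℝ[X]).continuous.continuousAt).congr ?_
  filter_upwards [Ioo_mem_nhds hx.1 hx.2] with y hy
  exact (M.toFun_eq z j ⟨hy.1, hy.2.le⟩).symm

theorem Mesh.continuous_primitive (M : Mesh a b N) (z : DGSpace N k) :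
    Continuous fun y => ∫ t in a..y, M.toFun z t := by
  refine intervalIntegral.continuous_primitive (fun c d => ?_) a
  rcases le_total c d with h | h
  · exact (M.bddMeas_toFun z c d).intervalIntegrable h
  · exact ((M.bddMeas_toFun z d c).intervalIntegrable h).symm

/-- Discrete Poincaré inequality: `D_{h,θ}⁻¹` is bounded on `Z_h` uniformly in the mesh. -/
theorem exists_poincare (hab : a < b) (k : ℕ) {θ : ℝ} (hθ : θ ≠ 1 / 2) : ∃ C : ℝ, 0 < C ∧
    ∀ (N : ℕ) (M : Mesh a b N) (z : DGSpace N k), z ∈ M.Zh k →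
      ip a b (M.toFun z) (M.toFun z) ≤ C * ip a b (M.toFun (M.D θ z)) (M.toFun (M.D θ z)) := by
  obtain ⟨K, hK, hst⟩ := exists_stability k hθ
  have hba : 0 < b - a := sub_pos.2 hab
  -- One `b - a` comes from bounding `L²` by the maximum, the other from Cauchy–Schwarz; `4 K²`
  -- squares the stability constant after mean zero has doubled it.
  refine ⟨(b - a) * (4 * K ^ 2) * (b - a), by positivity, fun N M z hz => ?_⟩
  have hf := M.bddMeas_toFun (M.D θ z) a b
  have hfi := hf.intervalIntegrable hab.le
  set G := ∫ t in a..b, |M.toFun (M.D θ z) t| with hG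
  have hG0 : 0 ≤ G := intervalIntegral.integral_nonneg hab.le fun x _ => abs_nonneg _
  set W : ℝ → ℝ := fun y => ∫ t in a..y, M.toFun (M.D θ z) t with hW
  have hWc : Continuous W := M.continuous_primitive _
  -- The primitive closes up periodically because `D_{h,θ} z` has mean zero.
  have hWab : W a = W b := by
    simp only [hW, intervalIntegral.integral_same]
    exact (M.mem_Zh.1 (M.D_mem_Zh hab.le θ z)).symm
  obtain ⟨c, hc⟩ := hst a b N M z 0 W G hWc hWab hG0
    (fun j x hx => by
      simpa using abs_integral_le_integral_abs_of_mem hab.le hfi ⟨le_rfl, hab.le⟩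
        (M.cell_subset j hx))
    (fun j q => by
      have hlr := (M.left_lt_right j).le
      have := intervalIntegral.integral_mul_deriv_eq_deriv_mul_of_hasDerivAt
        (a := M.left j) (b := M.right j)
        (u := W) (v := fun x => (q : ℝ[X]).eval x) (u' := fun x => (M.D θ z j : ℝ[X]).eval x)
        (v' := fun x => (derivative (q : ℝ[X])).eval x) hWc.continuousOn
        (q : ℝ[X]).continuous.continuousOn
        (fun x hx => by
          rw [min_eq_left hlr, max_eq_right hlr] at hx
          exact M.hasDerivAt_primitive _ j hx)
        (fun x _ => (q : ℝ[X]).hasDerivAt x)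
        ((M.D θ z j : ℝ[X]).continuous.intervalIntegrable _ _)
        ((derivative (q : ℝ[X])).continuous.intervalIntegrable _ _)
      linarith)
  have hsup : ∀ x ∈ Set.Ioo a b, |M.toFun z x| ≤ 2 * (K * G) := fun x hx =>
    abs_le_of_integral_eq_zero hab (M.bddMeas_toFun z a b) (M.mem_Zh.1 hz) (c := c)
      (fun y hy => by
        obtain ⟨j, hj⟩ := M.exists_mem_cell hy
        rw [M.toFun_eq z j hj]
        simpa using hc j y ⟨hj.1.le, hj.2⟩) ⟨hx.1, hx.2.le⟩
  have h1 := ip_self_le_of_abs_le hab.le (M.bddMeas_toFun z a b) hsup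
  have h2 := sq_integral_abs_le hab.le hf
  rw [← hG] at h2
  calc _ ≤ (b - a) * (2 * (K * G)) ^ 2 := h1
    _ = (b - a) * (4 * K ^ 2) * G ^ 2 := by ring
    _ ≤ (b - a) * (4 * K ^ 2) * ((b - a) *
        ip a b (M.toFun (M.D θ z)) (M.toFun (M.D θ z))) := by gcongr
    _ = _ := by ring

/-- The Poincaré inequality makes the kernel on `Z_h` trivial; an injective endomorphism of a
finite-dimensional space is surjective. -/
theorem Mesh.bijOn_D (M : Mesh a b N) (hab : a < b) (k : ℕ) {θ : ℝ} (hθ : θ ≠ 1 / 2) :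
    Set.BijOn (M.D θ) (M.Zh k) (M.Zh k) := by
  obtain ⟨C, hC, hP⟩ := exists_poincare hab k hθ
  have hker : ∀ z ∈ M.Zh k, M.D θ z = 0 → z = 0 := fun z hz h0 => by
    refine M.eq_zero_of_ip_self z (le_antisymm ?_ (ip_self_nonneg hab.le _))
    have := hP N M z hz
    rw [h0] at this
    refine this.trans (le_of_eq ?_)
    simp [Mesh.toFun, Mesh.ip_pw_pw]
  have hinj : Set.InjOn (M.D θ) (M.Zh k) := fun z hz y hy h =>
    sub_eq_zero.1 (hker _ (M.sub_mem_Zh hab.le hz hy) (by rw [M.D_sub, h, sub_self]))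
  refine ⟨fun z _ => M.D_mem_Zh hab.le θ z, hinj, fun f hf => ?_⟩
  have : Module.Finite ℝ (degreeLT ℝ (k + 1)) :=
    Module.Finite.equiv (degreeLTEquiv ℝ (k + 1)).symm
  let T : M.submoduleZh k →ₗ[ℝ] M.submoduleZh k := (M.linearD k θ).restrict fun z _ =>
    (M.mem_submoduleZh hab.le).2 (M.D_mem_Zh hab.le θ z)
  have hT : Function.Injective T := fun z y h => Subtype.ext
    (hinj ((M.mem_submoduleZh hab.le).1 z.2) ((M.mem_submoduleZh hab.le).1 y.2)
      (congrArg Subtype.val h))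
  have hsurj : Function.Surjective T := LinearMap.surjective_of_injective (K := ℝ) (V := M.submoduleZh k) (f := T) hT
  obtain ⟨z, hz⟩ := hsurj ⟨f, (M.mem_submoduleZh hab.le).2 hf⟩
  exact ⟨z, (M.mem_submoduleZh hab.le).1 z.2, congrArg Subtype.val hz⟩

theorem Mesh.Dinv_mem_Zh (M : Mesh a b N) (hab : a < b) {θ : ℝ} (hθ : θ ≠ 1 / 2)
    {f : DGSpace N k} (hf : f ∈ M.Zh k) : M.Dinv θ f ∈ M.Zh k :=
  Function.invFunOn_mem ((M.bijOn_D hab k hθ).surjOn hf)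

theorem Mesh.D_Dinv (M : Mesh a b N) (hab : a < b) {θ : ℝ} (hθ : θ ≠ 1 / 2)
    {f : DGSpace N k} (hf : f ∈ M.Zh k) : M.D θ (M.Dinv θ f) = f :=
  Function.invFunOn_eq ((M.bijOn_D hab k hθ).surjOn hf)

/-! ### Error of a single inverse -/

/-- Cellwise Taylor approximation. -/
theorem Mesh.exists_approx (M : Mesh a b N) (k : ℕ) {w : ℝ → ℝ}
    (hw : ContDiff ℝ ((k + 1 : ℕ) : WithTop ℕ∞) w) : ∃ T : DGSpace N k, ∀ j,
    ∀ x ∈ Set.Icc (M.left j) (M.right j), |w x - (T j : ℝ[X]).eval x| ≤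
      M.h ^ k * ∫ t in (M.left j)..(M.right j), |iteratedDeriv (k + 1) w t| := by
  choose T hTd hT using fun j => exists_taylor k w hw (M.left j) (M.right j) (M.left_lt_right j).le
  refine ⟨fun j => ⟨T j, mem_degreeLT.2 (hTd j)⟩, fun j x hx => (hT j x hx).trans ?_⟩
  refine mul_le_mul_of_nonneg_right (pow_le_pow_left₀ (sub_nonneg.2 (M.left_lt_right j).le)
    (M.cellLength_le_h j) k) ?_
  exact intervalIntegral.integral_nonneg (M.left_lt_right j).le fun x _ => abs_nonneg _

/-- The error estimate for a single inverse. -/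
theorem exists_error_bound_one (hab : a < b) (k : ℕ) {θ : ℝ} (hθ : θ ≠ 1 / 2) :
    ∃ C : ℝ, 0 < C ∧ ∀ (N : ℕ) (M : Mesh a b N) (w : ℝ → ℝ),
      ContDiff ℝ ((k + 2 : ℕ) : WithTop ℕ∞) w → Function.Periodic w (b - a) →
      ∫ x in a..b, w x = 0 → ∀ z ∈ M.Zh k, M.D θ z = M.proj k (deriv w) →
      ip a b (fun x => w x - M.toFun z x) (fun x => w x - M.toFun z x) ≤
        C * ip a b (iteratedDeriv (k + 2) w) (iteratedDeriv (k + 2) w) * (M.h ^ (k + 1)) ^ 2 := by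
  obtain ⟨K, hK, hst⟩ := exists_stability k hθ
  have hba : 0 < b - a := sub_pos.2 hab
  refine ⟨(b - a) * (4 * (K + 1) ^ 2) * (b - a), by positivity, fun N M w hw hp h0 z hz hD => ?_⟩
  have hw1 : ContDiff ℝ ((k + 1 : ℕ) : WithTop ℕ∞) w := hw.of_le (by exact_mod_cast Nat.le_succ _)
  have hwd : Continuous (deriv w) := by
    simpa using hw.continuous_iteratedDeriv 1 (by exact_mod_cast Nat.le_add_left 1 (k + 1))
  obtain ⟨T, hT⟩ := M.exists_approx k hw1
  have hcont := hw.continuous_iteratedDeriv (k + 2) le_rfl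
  set S := ∫ t in a..b, |iteratedDeriv (k + 2) w t| with hS
  have hS0 : 0 ≤ S := intervalIntegral.integral_nonneg hab.le fun x _ => abs_nonneg _
  -- One derivative beyond `k + 1` is spent on a maximum bound, which turns the cellwise integral of
  -- the Taylor estimate into a further factor `h`.
  have hder : ∀ x ∈ Set.Icc a b, |iteratedDeriv (k + 1) w x| ≤ S := fun x hx => by
    have h2 : ContDiff ℝ 2 (iteratedDeriv k w) := by
      rw [iteratedDeriv_eq_iterate]
      exact ContDiff.iterate_deriv' 2 k (by rw [add_comm 2 k]; exact hw)
    have := abs_deriv_le_of_periodic hab h2 (periodic_iteratedDeriv hp k) hx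
    rwa [← iteratedDeriv_succ, ← iteratedDeriv_succ] at this
  set G := M.h ^ (k + 1) * S with hG
  have hh := M.h_nonneg
  have hG0 : 0 ≤ G := by positivity
  have hTG : ∀ j, ∀ x ∈ Set.Icc (M.left j) (M.right j), |w x - (T j : ℝ[X]).eval x| ≤ G := by
    intro j x hx
    refine (hT j x hx).trans ?_
    have hlr := (M.left_lt_right j).le
    have h1 : ∫ t in (M.left j)..(M.right j), |iteratedDeriv (k + 1) w t| ≤
        ∫ _ in (M.left j)..(M.right j), S :=
      intervalIntegral.integral_mono_on hlr
        ((hw1.continuous_iteratedDeriv (k + 1) le_rfl).abs.intervalIntegrable _ _) (by simp)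
        fun x hx => hder x (M.cell_subset j hx)
    rw [intervalIntegral.integral_const, smul_eq_mul] at h1
    have h2 := M.cellLength_le_h j
    calc _ ≤ M.h ^ k * (M.h * S) := by gcongr; exact h1.trans (by gcongr)
      _ = G := by rw [hG]; ring
  obtain ⟨c, hc⟩ := hst a b N M z T w G hw.continuous (periodic_endpoints hp) hG0 hTG
    (fun j q => by
      rw [hD, M.integral_proj_mul hwd]
      have := intervalIntegral.integral_mul_deriv_eq_deriv_mul
        (a := M.left j) (b := M.right j)
        (u := w) (v := fun x => (q : ℝ[X]).eval x) (u' := deriv w)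
        (v' := fun x => (derivative (q : ℝ[X])).eval x)
        (fun x _ => (hw.differentiable (by simp) x).hasDerivAt)
        (fun x _ => (q : ℝ[X]).hasDerivAt x) (hwd.intervalIntegrable _ _)
        ((derivative (q : ℝ[X])).continuous.intervalIntegrable _ _)
      linarith)
  have hwm : BddMeas a b w := .of_continuous hw.continuous
  have hzm := M.bddMeas_toFun z a b
  have hsup : ∀ x ∈ Set.Ioo a b, |w x - M.toFun z x| ≤ 2 * ((K + 1) * G) := fun x hx =>
    abs_le_of_integral_eq_zero hab (hwm.sub hzm)
      (by rw [intervalIntegral.integral_sub (hwm.intervalIntegrable hab.le)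
        (hzm.intervalIntegrable hab.le), h0, M.mem_Zh.1 hz, sub_zero]) (c := -c)
      (fun y hy => by
        obtain ⟨j, hj⟩ := M.exists_mem_cell hy
        rw [M.toFun_eq z j hj]
        have h1 := hc j y ⟨hj.1.le, hj.2⟩
        have h2 := hTG j y ⟨hj.1.le, hj.2⟩
        have e : w y - (z j : ℝ[X]).eval y - -c = (w y - (T j : ℝ[X]).eval y) -
          ((z j : ℝ[X]).eval y - c - (T j : ℝ[X]).eval y) := by ring
        rw [e]
        refine (abs_sub _ _).trans ?_
        linarith) ⟨hx.1, hx.2.le⟩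
  have h1 := ip_self_le_of_abs_le hab.le (hwm.sub hzm) hsup
  have h2 := sq_integral_abs_le hab.le (.of_continuous hcont)
  rw [← hS] at h2
  calc _ ≤ (b - a) * (2 * ((K + 1) * G)) ^ 2 := h1
    _ = (b - a) * (4 * (K + 1) ^ 2) * S ^ 2 * (M.h ^ (k + 1)) ^ 2 := by rw [hG]; ring
    _ ≤ (b - a) * (4 * (K + 1) ^ 2) * ((b - a) *
        ip a b (iteratedDeriv (k + 2) w) (iteratedDeriv (k + 2) w)) * (M.h ^ (k + 1)) ^ 2 := by
      gcongr
    _ = _ := by ring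

/-! ### Estimates for the `L²` projection -/

/-- `Π₀ w` is the best approximation of `w` in `V_h`. -/
theorem Mesh.ip_sub_proj_le (M : Mesh a b N) (hab : a ≤ b) {w : ℝ → ℝ} (hw : Continuous w)
    (T : DGSpace N k) :
    ip a b (fun x => w x - M.toFun (M.proj k w) x) (fun x => w x - M.toFun (M.proj k w) x) ≤
      ip a b (fun x => w x - M.toFun T x) (fun x => w x - M.toFun T x) := by
  have hwm : BddMeas a b w := .of_continuous hw
  have hP := M.bddMeas_toFun (M.proj k w) a b
  have hT := M.bddMeas_toFun T a b
  have h1 : ip a b (fun x => w x - M.toFun (M.proj k w) x) (M.toFun (M.proj k w - T)) = 0 := by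
    rw [ip_sub_left hab hwm hP (M.bddMeas_toFun _ a b), M.ip_proj hw, sub_self]
  have h2 := ip_add_self hab (hwm.sub hP) (M.bddMeas_toFun (M.proj k w - T) a b)
  rw [h1] at h2
  have e : (fun x => w x - M.toFun T x) =
      fun x => w x - M.toFun (M.proj k w) x + M.toFun (M.proj k w - T) x := by
    funext x; rw [M.toFun_sub]; ring
  rw [e, h2]
  linarith [ip_self_nonneg hab (M.toFun (M.proj k w - T))]

/-- The projection `Π₀` does not increase the distance to elements of `V_h`. -/
theorem Mesh.ip_proj_sub_le (M : Mesh a b N) (hab : a ≤ b) {w : ℝ → ℝ} (hw : Continuous w)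
    (y : DGSpace N k) :
    ip a b (M.toFun (M.proj k w - y)) (M.toFun (M.proj k w - y)) ≤
      ip a b (fun x => w x - M.toFun y x) (fun x => w x - M.toFun y x) := by
  have hwm : BddMeas a b w := .of_continuous hw
  have hP := M.bddMeas_toFun (M.proj k w) a b
  have hy := M.bddMeas_toFun y a b
  have hv := M.bddMeas_toFun (M.proj k w - y) a b
  have h1 : ip a b (M.toFun (M.proj k w - y)) (M.toFun (M.proj k w - y)) =
      ip a b (fun x => w x - M.toFun y x) (M.toFun (M.proj k w - y)) := by
    conv_lhs => rw [M.toFun_sub (M.proj k w) y]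
    rw [← M.toFun_sub (M.proj k w) y, ip_sub_left hab hwm hy hv, ← M.ip_proj hw,
      ← ip_sub_left hab hP hy hv, ← M.toFun_sub]
  have h2 := ip_sub_self hab (hwm.sub hy) hv
  have h3 := ip_self_nonneg hab fun x => w x - M.toFun y x - M.toFun (M.proj k w - y) x
  linarith

/-- This is the case without inverses, where only `k + 1` derivatives are available and the maximum
bound used for a single inverse is out of reach. On each cell the Taylor estimate is squared, and
Cauchy–Schwarz and the cell length each contribute one `h`; the remaining local integrals add up to
the global one. -/
theorem Mesh.ip_sub_proj_le_h_pow (M : Mesh a b N) (hab : a < b) {w : ℝ → ℝ}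
    (hw : ContDiff ℝ ((k + 1 : ℕ) : WithTop ℕ∞) w) :
    ip a b (fun x => w x - M.toFun (M.proj k w) x) (fun x => w x - M.toFun (M.proj k w) x) ≤
      ip a b (iteratedDeriv (k + 1) w) (iteratedDeriv (k + 1) w) * (M.h ^ (k + 1)) ^ 2 := by
  obtain ⟨T, hT⟩ := M.exists_approx k hw
  refine (M.ip_sub_proj_le hab.le hw.continuous T).trans ?_
  have hcont := hw.continuous_iteratedDeriv (k + 1) le_rfl
  set u := iteratedDeriv (k + 1) w
  have hlr := fun j => (M.left_lt_right j).le
  have hh := M.h_nonneg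
  have hsub : ∀ j c d, BddMeas c d fun x => w x - (T j : ℝ[X]).eval x := fun j c d =>
    .of_continuous (hw.continuous.sub (T j : ℝ[X]).continuous)
  have key : ∀ j, Set.EqOn (fun x => (w x - (T j : ℝ[X]).eval x) * (w x - (T j : ℝ[X]).eval x))
      (fun x => (w x - M.toFun T x) * (w x - M.toFun T x))
      (Set.uIoc (M.left j) (M.right j)) := fun j x hx => by
    rw [Set.uIoc_of_le (hlr j)] at hx
    simp only [M.toFun_eq T j hx]
  have hbd : ∀ j, BddMeas (M.left j) (M.right j) u := fun j => .of_continuous hcont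
  have hcell : ∀ j, ∫ x in (M.left j)..(M.right j),
      (w x - M.toFun T x) * (w x - M.toFun T x) ≤
      ip (M.left j) (M.right j) u u * (M.h ^ (k + 1)) ^ 2 := fun j => by
    have e : ∫ x in (M.left j)..(M.right j), (w x - M.toFun T x) * (w x - M.toFun T x) =
        ip (M.left j) (M.right j) (fun x => w x - (T j : ℝ[X]).eval x)
          (fun x => w x - (T j : ℝ[X]).eval x) :=
      (intervalIntegral.integral_congr_ae (Filter.Eventually.of_forall fun x hx => key j hx)).symm
    rw [e]
    have h1 := ip_self_le_of_abs_le (hlr j) (hsub j _ _)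
      (fun x hx => hT j x ⟨hx.1.le, hx.2.le⟩)
    have h2 := sq_integral_abs_le (hlr j) (hbd j)
    have h3 := M.cellLength_le_h j
    have h4 := ip_self_nonneg (hlr j) u
    calc _ ≤ (M.right j - M.left j) * (M.h ^ k * ∫ t in (M.left j)..(M.right j), |u t|) ^ 2 := h1
      _ = (M.right j - M.left j) * (M.h ^ k) ^ 2 * (∫ t in (M.left j)..(M.right j), |u t|) ^ 2 := by
        ring
      _ ≤ M.h * (M.h ^ k) ^ 2 * (M.h * ip (M.left j) (M.right j) u u) := by
        gcongr
        exact h2.trans (by gcongr)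
      _ = _ := by ring
  unfold ip
  rw [M.integral_eq_sum, M.integral_eq_sum, Finset.sum_mul]
  · exact Finset.sum_le_sum fun j _ => hcell j
  · exact fun j => (hcont.mul hcont).intervalIntegrable _ _
  · exact fun j => (((hsub j _ _).mul (hsub j _ _)).intervalIntegrable (hlr j)).congr (key j)

/-! ### Induction on the number of inverses -/

/-- The square of the Sobolev norm. -/
noncomputable def sobolevSq (a b : ℝ) (m : ℕ) (f : ℝ → ℝ) : ℝ :=
  ∑ l ∈ Finset.range (m + 1), ip a b (iteratedDeriv l f) (iteratedDeriv l f)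

theorem ip_iteratedDeriv_le_sobolevSq (hab : a ≤ b) {l m : ℕ} (hl : l ≤ m) (f : ℝ → ℝ) :
    ip a b (iteratedDeriv l f) (iteratedDeriv l f) ≤ sobolevSq a b m f :=
  Finset.single_le_sum (f := fun l => ip a b (iteratedDeriv l f) (iteratedDeriv l f))
    (fun _ _ => ip_self_nonneg hab _) (Finset.mem_range.2 (Nat.lt_succ_of_le hl))

theorem sobolevSq_deriv_le (hab : a ≤ b) (m : ℕ) (f : ℝ → ℝ) :
    sobolevSq a b m (deriv f) ≤ sobolevSq a b (m + 1) f := by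
  unfold sobolevSq
  rw [Finset.sum_range_succ' _ (m + 1)]
  simp only [iteratedDeriv_succ']
  linarith [ip_self_nonneg hab (iteratedDeriv 0 f)]

/-- Induction on `i`, applied to `w'` in the step. Membership in `Z_h` is carried along because
`Dinv` is a genuine inverse only there. -/
theorem exists_error_bound (hab : a < b) (k : ℕ) (θ : ℕ → ℝ) (i : ℕ)
    (hθ : ∀ j, 1 ≤ j → j ≤ i → θ j ≠ 1 / 2) : ∃ C : ℝ, 0 < C ∧
    ∀ (N : ℕ) (M : Mesh a b N) (w : ℝ → ℝ),
      ContDiff ℝ ((k + 1 + i : ℕ) : WithTop ℕ∞) w → Function.Periodic w (b - a) →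
      ∫ x in a..b, w x = 0 →
      M.proj k (iteratedDeriv i w) ∈ M.Zh k ∧
      M.DinvIter θ i (M.proj k (iteratedDeriv i w)) ∈ M.Zh k ∧
      ip a b (fun x => w x - M.toFun (M.DinvIter θ i (M.proj k (iteratedDeriv i w))) x)
          (fun x => w x - M.toFun (M.DinvIter θ i (M.proj k (iteratedDeriv i w))) x) ≤
        C * sobolevSq a b (k + 1 + i) w * (M.h ^ (k + 1)) ^ 2 := by
  induction i with
  | zero =>
    refine ⟨1, one_pos, fun N M w hw hp h0 => ?_⟩
    rw [iteratedDeriv_zero]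
    have hz := M.proj_mem_Zh (k := k) hab.le hw.continuous h0
    refine ⟨hz, hz, (M.ip_sub_proj_le_h_pow hab hw).trans ?_⟩
    rw [one_mul]
    gcongr
    exact ip_iteratedDeriv_le_sobolevSq hab.le le_rfl w
  | succ i ih =>
    obtain ⟨C, hC, hE⟩ := ih fun j h1 h2 => hθ j h1 (h2.trans (Nat.le_succ i))
    have hθi := hθ (i + 1) (by omega) le_rfl
    obtain ⟨A, hA, hpoinc⟩ := exists_poincare hab k hθi
    obtain ⟨B, hB, hone⟩ := exists_error_bound_one hab k hθi
    -- The factors 2 come from `ip_add_self_le`: `B` for the single inverse, `A * C` for the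
    -- inherited error passed through the last inverse.
    refine ⟨2 * B + 2 * (A * C), by positivity, fun N M w hw hp h0 => ?_⟩
    have hd : ContDiff ℝ ((k + 1 + i : ℕ) : WithTop ℕ∞) (deriv w) := by
      rw [← add_assoc, Nat.cast_succ, contDiff_succ_iff_deriv] at hw
      exact hw.2.2
    have hw1 : ContDiff ℝ 1 w := hw.of_le (by exact_mod_cast (by omega : 1 ≤ k + 1 + (i + 1)))
    have hd0 := integral_deriv_periodic hw1 hp
    obtain ⟨hproj, hy, herr⟩ := hE N M (deriv w) hd (periodic_deriv hp) hd0
    rw [iteratedDeriv_succ']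
    set y := M.DinvIter θ i (M.proj k (iteratedDeriv i (deriv w))) with hydef
    change _ ∧ M.Dinv (θ (i + 1)) y ∈ M.Zh k ∧ ip a b
      (fun x => w x - M.toFun (M.Dinv (θ (i + 1)) y) x)
      (fun x => w x - M.toFun (M.Dinv (θ (i + 1)) y) x) ≤ _
    have hz2 := M.Dinv_mem_Zh hab hθi hy
    refine ⟨hproj, hz2, ?_⟩
    have hp1 := M.proj_mem_Zh (k := k) hab.le hd.continuous hd0
    have hz1 := M.Dinv_mem_Zh hab hθi hp1
    set z1 := M.Dinv (θ (i + 1)) (M.proj k (deriv w)) with hz1def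
    set z2 := M.Dinv (θ (i + 1)) y with hz2def
    have e1 := hone N M w (hw.of_le (by exact_mod_cast (by omega : k + 2 ≤ k + 1 + (i + 1)))) hp h0
      z1 hz1 (M.D_Dinv hab hθi hp1)
    -- `D (z1 - z2) = Π₀ w' - y`, and this is no larger than `w' - y`, the error given by the
    -- induction hypothesis.
    have e2 := hpoinc N M (z1 - z2) (M.sub_mem_Zh hab.le hz1 hz2)
    rw [M.D_sub, M.D_Dinv hab hθi hp1, M.D_Dinv hab hθi hy] at e2
    have e3 := M.ip_proj_sub_le hab.le hd.continuous y
    have e : (fun x => w x - M.toFun z2 x) =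
        fun x => (w x - M.toFun z1 x) + M.toFun (z1 - z2) x := by
      funext x; rw [M.toFun_sub]; ring
    rw [e]
    have e4 := ip_add_self_le hab.le ((BddMeas.of_continuous hw.continuous).sub
      (M.bddMeas_toFun z1 a b)) (M.bddMeas_toFun (z1 - z2) a b)
    have hS1 := ip_iteratedDeriv_le_sobolevSq hab.le (by omega : k + 2 ≤ k + 1 + (i + 1)) w
    have hS2 := sobolevSq_deriv_le hab.le (k + 1 + i) w
    rw [add_assoc (k + 1) i 1] at hS2
    set S := sobolevSq a b (k + 1 + (i + 1)) w
    have f1 : ip a b (fun x => w x - M.toFun z1 x) (fun x => w x - M.toFun z1 x) ≤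
        B * S * (M.h ^ (k + 1)) ^ 2 := e1.trans (by gcongr)
    have f2 : ip a b (M.toFun (z1 - z2)) (M.toFun (z1 - z2)) ≤
        A * (C * S * (M.h ^ (k + 1)) ^ 2) := by
      refine e2.trans (mul_le_mul_of_nonneg_left (e3.trans (herr.trans ?_)) hA.le)
      gcongr
    linarith

end PeriodicDG

theorem mainTheorem6 (a b : ℝ) (hab : a < b) (k i : ℕ) (ν : ℝ) (θ : ℕ → ℝ)
    (hθ : ∀ j, 1 ≤ j → j ≤ i → θ j ≠ 1 / 2) :
    ∃ C : ℝ, 0 < C ∧ ∀ (N : ℕ) (M : PeriodicDG.Mesh a b N), M.QuasiUniform ν →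
      (∀ j, 1 ≤ j → j ≤ i → Set.BijOn (M.D (θ j)) (M.Zh k) (M.Zh k)) ∧
      ∀ w : ℝ → ℝ, ContDiff ℝ ((k + 1 + i : ℕ) : WithTop ℕ∞) w →
        Function.Periodic w (b - a) → (∫ x in a..b, w x) = 0 →
        M.proj k (iteratedDeriv i w) ∈ M.Zh k ∧
        PeriodicDG.l2norm a b
            (fun x => w x - M.toFun (M.DinvIter θ i (M.proj k (iteratedDeriv i w))) x) ≤
          C * PeriodicDG.sobolevNorm a b (k + 1 + i) w * M.h ^ (k + 1) := by
  obtain ⟨C, hC, hE⟩ := PeriodicDG.exists_error_bound hab k θ i hθ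
  -- The bound in `exists_error_bound` is for squared norms.
  refine ⟨√C, Real.sqrt_pos.2 hC, fun N M _ =>
    ⟨fun j h1 h2 => M.bijOn_D hab k (hθ j h1 h2), fun w hw hp h0 => ?_⟩⟩
  obtain ⟨hz, -, herr⟩ := hE N M w hw hp h0
  refine ⟨hz, (Real.sqrt_le_sqrt herr).trans (le_of_eq ?_)⟩
  have hh := M.h_nonneg
  rw [Real.sqrt_mul' _ (by positivity), Real.sqrt_mul hC.le, Real.sqrt_sq (by positivity)]
  rfl
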